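/- Conventions. Let $\mathcal H$ be a separable complex Hilbert space and $(\Omega,\mathcal B_\Omega,\mathbb P)$ a probability space. For a probability measure $\mu$ on $\mathbb R$ and $0<\alpha\le 1$, call $\mu$ uniformly $\alpha$-Hölder continuous if $$\sup_{x\in\mathbb R}\ \sup_{0<\epsilon\le 1}\frac{\mu((x-\epsilon,x+\epsilon))}{(2\epsilon)^\alpha}<\infty ,\qquad\text{and put}\qquad d_\mu^{\alpha,\infty}=\sup_{x\in\mathbb R}\ \sup_{\epsilon>0}\frac{\mu((x-\epsilon,x+\epsilon))}{(2\epsilon)^\alpha}.$$ For a (possibly unbounded) self-adjoint operator $B$ on $\mathcal H$ let $E_B(\cdot)$ be its projection-valued spectral measure, and for a unit vector $\phi$ let $P_\phi$ be the orthogonal projection onto $\mathbb C\phi$. Theorem 1.1. Let $A$ be a random variable on $\Omega$ with values in the (possibly unbounded) self-adjoint operators on $\mathcal H$ (each $A^\omega$ is self-adjoint, and the resolvents $(A^\omega+i)^{-1}$ are weakly measurable in $\omega$), and let $q$ be a real random variable on $\Omega$ that is independent of $A$, in the sense that for all $f,g\in\mathcal H$ and all bounded measurable $\psi$ on $\mathbb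 R$, $q$ is independent of $\langle f,\psi(A)g\rangle$, and also of $\langle f,Ag\rangle$ when $g$ lies in the domain of $A^\omega$ for every $\omega$. Let $\phi\in\mathcal H$ be a unit vector, and suppose that the distribution $\mu$ of $q$ is uniformly $\alpha$-Hölder continuous, $0<\alpha\le 1$. For each $\omega$, with $A^\omega$ fixed, let $$\nu_{A^\omega}(\cdot)=\int_{\mathbb R}\langle\phi,E_{A^\omega+tP_\phi}(\cdot)\,\phi\rangle\,d\mu(t)$$ be the spectral measure of $H=A+qP_\phi$ at $\phi$, averaged over $q$. Then the measures $\langle\phi,E_{A^\omega+tP_\phi}(\cdot)\phi\rangle$ depend measurably on $t$ for each $\omega$, the measures $\nu_{A^\omega}$ depend measurably on $\omega$, and: 1. for every $\omega$, $\nu_{A^\omega}$ is a probability measure that is uniformly $\alpha$-Hölder continuous, with the same exponent $\alpha$; 2. for every $\omega$, $d_{\nu_{A^\omega}}^{\alpha,\infty}\le 2^{2-\alpha}\,\pi\,d_\mu^{\alpha,\infty}$; 3. $\mathbb E(\nu_{A^\omega})=\int_\Omega\nu_{A^\omega}(\cdot)\,d\mathbb P(\omega)$ is a probability measure that is uniformly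 $\alpha$-Hölder continuous, with the same exponent $\alpha$. -/

import Mathlib

open MeasureTheory ProbabilityTheory
open scoped ENNReal InnerProductSpace

noncomputable section

namespace RankOneAveraging

/-! ### Uniform Hölder continuity of measures on the line -/

/-- The constant `d_μ^{α,∞} = sup_x sup_{ε > 0} μ((x - ε, x + ε)) / (2ε)^α`, as an element of
`[0, ∞]`; only `ε > 0` is allowed, so the denominators are positive and finite. -/
def holderConst (α : ℝ) (μ : Measure ℝ) : ℝ≥0∞ :=
  ⨆ (x : ℝ) (ε : ℝ) (_ : 0 < ε), μ (Set.Ioo (x - ε) (x + ε)) / ENNReal.ofReal ((2 * ε) ^ α)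

/-- `μ` is a probability measure on `ℝ` which is uniformly `α`-Hölder continuous:
`sup_x sup_{0 < ε ≤ 1} μ((x - ε, x + ε)) / (2ε)^α < ∞`. -/
def IsUniformlyHolder (α : ℝ) (μ : Measure ℝ) : Prop :=
  IsProbabilityMeasure μ ∧
    (⨆ (x : ℝ) (ε : ℝ) (_ : 0 < ε ∧ ε ≤ 1),
      μ (Set.Ioo (x - ε) (x + ε)) / ENNReal.ofReal ((2 * ε) ^ α)) < ∞

/-! ### Projection-valued measures and spectral measures of self-adjoint operators -/

variable {H : Type*} [NormedAddCommGroup H] [InnerProductSpace ℂ H] [CompleteSpace H]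

variable (H) in
/-- A projection-valued (Borel) measure on `ℝ` in the Hilbert space `H`, countably additive in the
strong operator topology. As for Mathlib's vector measures, the value on non-measurable sets is
normalized to be `0`. -/
structure ProjectionValuedMeasure where
  toFun : Set ℝ → H →L[ℂ] H
  isStarProjection : ∀ S, MeasurableSet S → IsStarProjection (toFun S)
  not_measurable : ∀ S, ¬ MeasurableSet S → toFun S = 0
  univ : toFun Set.univ = 1
  iUnion : ∀ S : ℕ → Set ℝ, (∀ n, MeasurableSet (S n)) →
    Pairwise (Function.onFun Disjoint S) →
      ∀ x : H, HasSum (fun n => toFun (S n) x) (toFun (⋃ n, S n) x)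

namespace ProjectionValuedMeasure

theorem empty_apply (E : ProjectionValuedMeasure H) (x : H) : E.toFun ∅ x = 0 := by
  have h := E.iUnion (fun _ => ∅) (fun _ => MeasurableSet.empty)
    (fun _ _ _ => by simp [Function.onFun]) x
  exact (summable_const_iff _).mp h.summable

theorem inner_eq (E : ProjectionValuedMeasure H) {S : Set ℝ} (hS : MeasurableSet S) (x : H) :
    (⟪x, E.toFun S x⟫_ℂ).re = ‖E.toFun S x‖ ^ 2 := by
  have h := E.isStarProjection S hS
  have h1 : E.toFun S (E.toFun S x) = E.toFun S x := congrArg (fun T => T x) h.isIdempotentElem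
  have h2 : ⟪x, E.toFun S x⟫_ℂ = ⟪E.toFun S x, E.toFun S x⟫_ℂ := by
    conv_lhs => rw [← h1, ← ContinuousLinearMap.adjoint_inner_left]
    rw [h.isSelfAdjoint.adjoint_eq]
  rw [h2]
  exact inner_self_eq_norm_sq (𝕜 := ℂ) _

/-- The scalar measure `⟨x, E(·) x⟩` of the vector `x`. -/
def scalarMeasure (E : ProjectionValuedMeasure H) (x : H) : Measure ℝ :=
  Measure.ofMeasurable (fun S _ => ENNReal.ofReal (⟪x, E.toFun S x⟫_ℂ).re)
    (by simp [empty_apply])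
    (by
      intro S hS hd
      have h := (E.iUnion S hS hd x).mapL (innerSL ℂ x)
      have h' := Complex.hasSum_re h
      simp only [innerSL_apply_apply] at h'
      rw [← h'.tsum_eq]
      refine ENNReal.ofReal_tsum_of_nonneg (fun n => ?_) h'.summable
      rw [inner_eq E (hS n)]
      positivity)

theorem scalarMeasure_apply (E : ProjectionValuedMeasure H) (x : H) {S : Set ℝ}
    (hS : MeasurableSet S) :
    E.scalarMeasure x S = ENNReal.ofReal (⟪x, E.toFun S x⟫_ℂ).re :=
  Measure.ofMeasurable_apply S hS

open Classical in
/-- The projection-valued measure concentrated at the point `a` (the spectral measure of the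
operator `a • 1`). -/
def dirac (a : ℝ) : ProjectionValuedMeasure H where
  toFun S := if MeasurableSet S ∧ a ∈ S then 1 else 0
  isStarProjection S _ := by
    split_ifs
    · exact .one _
    · exact .zero _
  not_measurable S hS := by simp [hS]
  univ := by simp
  iUnion S hS hd x := by
    by_cases h : ∃ n, a ∈ S n
    · obtain ⟨n, hn⟩ := h
      have key : ∀ m, m ≠ n → a ∉ S m := fun m hm ha =>
        Set.disjoint_left.mp (hd hm) ha hn
      have hU : a ∈ ⋃ n, S n := Set.mem_iUnion.mpr ⟨n, hn⟩
      simp only [MeasurableSet.iUnion hS, hU, and_self, if_true]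
      have := hasSum_single (f := fun m =>
        (if MeasurableSet (S m) ∧ a ∈ S m then (1 : H →L[ℂ] H) else 0) x) n
        (fun m hm => by simp [key m hm])
      simpa [hS n, hn] using this
    · have hU : a ∉ ⋃ n, S n := by simpa using h
      push Not at h
      simp [hU, h, hasSum_zero]

instance : Inhabited (ProjectionValuedMeasure H) := ⟨dirac 0⟩

/-- `E` is the spectral measure of the (possibly unbounded) operator `B`, that is,
`B = ∫ s dE(s)`: the domain of `B` consists of the `x` with `∫ s² d⟨x, E(s) x⟩ < ∞`, and
`⟨x, B x⟩ = ∫ s d⟨x, E(s) x⟩` for these `x`. -/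
def IsSpectralMeasureOf (E : ProjectionValuedMeasure H) (B : H →ₗ.[ℂ] H) : Prop :=
  (∀ x : H, x ∈ B.domain ↔ Integrable (fun s : ℝ => s ^ 2) (E.scalarMeasure x)) ∧
    ∀ x : B.domain, ⟪(x : H), B x⟫_ℂ = ((∫ s, s ∂(E.scalarMeasure (x : H)) : ℝ) : ℂ)

end ProjectionValuedMeasure

open Classical in
/-- The projection-valued spectral measure `E_B` of a self-adjoint operator `B`. By the spectral
theorem it exists and is unique; for operators without one, the value is irrelevant. -/
def spectralMeasure (B : H →ₗ.[ℂ] H) : ProjectionValuedMeasure H :=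
  if h : ∃ E : ProjectionValuedMeasure H, E.IsSpectralMeasureOf B then h.choose else default

/-- The matrix element `⟨f, ψ(B) g⟩` of the Borel functional calculus
`ψ(B) = ∫ ψ(s) dE_B(s)`, for bounded measurable `ψ`. It is written out by polarization
in terms of the quadratic form `⟨x, ψ(B) x⟩ = ∫ ψ(s) d⟨x, E_B(s) x⟩`. -/
def functionalCalculusInner (B : H →ₗ.[ℂ] H) (ψ : ℝ → ℂ) (f g : H) : ℂ :=
  let Q : H → ℂ := fun x => ∫ s, ψ s ∂((spectralMeasure B).scalarMeasure x)
  (Q (f + g) - Q (f - g) - Complex.I * Q (f + Complex.I • g) + Complex.I * Q (f - Complex.I • g)) / 4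

/-- The resolvent `(B - z)⁻¹`, as the inverse of the map `x ↦ B x - z x` on the domain of `B`.
(For `B` self-adjoint and `z` not real this map is a bijection onto `H`.) -/
def resolvent (B : H →ₗ.[ℂ] H) (z : ℂ) (y : H) : H :=
  (Function.invFun (fun x : B.domain => B x - z • (x : H)) y : B.domain)

/-! ### Random operators and rank one perturbations -/

section Random

variable {Ω : Type*} [MeasurableSpace Ω]

/-- `A` is a random variable with values in the (possibly unbounded) self-adjoint operators: each
`A ω` is self-adjoint, and the resolvents `(A ω + i)⁻¹` are weakly measurable in `ω`. -/
def IsSelfAdjointRandomOperator (A : Ω → H →ₗ.[ℂ] H) : Prop :=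
  (∀ ω, IsSelfAdjoint (A ω)) ∧
    ∀ f g : H, Measurable fun ω => ⟪f, resolvent (A ω) (-Complex.I) g⟫_ℂ

/-- Independence of the random operator `A` and the random variable `q`: `q` is independent
of `⟨f, A g⟩` (whenever `g` lies in the domain of every `A ω`) and of `⟨f, ψ(A) g⟩`, for all
vectors `f, g` and all bounded measurable `ψ`. -/
def IsIndependentOf (P : Measure Ω) (A : Ω → H →ₗ.[ℂ] H) (q : Ω → ℝ) : Prop :=
  (∀ (f g : H) (hg : ∀ ω, g ∈ (A ω).domain),
      IndepFun q (fun ω => ⟪f, A ω ⟨g, hg ω⟩⟫_ℂ) P) ∧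
    ∀ (f g : H) (ψ : ℝ → ℂ), Measurable ψ → (∃ C : ℝ, ∀ s, ‖ψ s‖ ≤ C) →
      IndepFun q (fun ω => functionalCalculusInner (A ω) ψ f g) P

end Random

/-- The operator `A + t P_φ`, with the domain of `A`, where `P_φ` is the orthogonal projection onto
the span of `φ`. -/
def rankOnePerturbation (A : H →ₗ.[ℂ] H) (φ : H) (t : ℝ) : H →ₗ.[ℂ] H :=
  (((t : ℂ) • (ℂ ∙ φ).starProjection : H →L[ℂ] H) : H →ₗ[ℂ] H) +ᵥ A

/-- The measure `⟨φ, E_{A + t P_φ}(·) φ⟩`. -/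
def perturbedSpectralMeasure (A : H →ₗ.[ℂ] H) (φ : H) (t : ℝ) : Measure ℝ :=
  (spectralMeasure (rankOnePerturbation A φ t)).scalarMeasure φ

/-- The averaged spectral measure `ν_A = ∫ ⟨φ, E_{A + t P_φ}(·) φ⟩ dμ(t)`. -/
def averagedSpectralMeasure (μ : Measure ℝ) (A : H →ₗ.[ℂ] H) (φ : H) : Measure ℝ :=
  μ.bind (perturbedSpectralMeasure A φ)

end RankOneAveraging

end

/-! Fix a self-adjoint `A`, put z = x - iε and F = ⟨φ, (A - z)⁻¹φ⟩, so that Im F < 0. The kernel ε /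
((s - x)² + ε²) = ε|s - z|⁻² is at least 1/(2ε) on (x - ε, x + ε), so its integral controls the mass
of that interval. Against the spectral measure of A + tP_φ at φ it integrates to ε‖(A + tP_φ -
z)⁻¹φ‖², which the rank one resolvent formula (Aronszajn–Krein) turns into -Im F / |1 + tF|². As a
function of t this is again such a kernel, with centre -Re F / |F|² and width v = -Im F / |F|².
Averaging over t therefore produces a Poisson integral of μ itself. Since |F| ≤ ‖(A - z)⁻¹φ‖ and -Im
F = ε‖(A - z)⁻¹φ‖², the width satisfies v ≥ ε.

For a Hölder continuous μ with constant d, a layer-cake estimate (`lintegral_lorentzian_le`) bounds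
this integral by d (1 + π/2) (2v)^α / v. As α ≤ 1 this does not increase with v, so v may be
replaced by ε. Multiplication by 2ε gives (2 + π) d (2ε)^α, and 2 + π ≤ 2^(2 - α) π. The bound is
uniform in ω and survives the expectation.

Two foundations are needed. First, `spectralMeasure` is a choice, so existence is proved from the
continuous functional calculus of the normal operator (B + i)⁻¹. Uniqueness is not needed:
`lintegral_inv_normSq_sub` holds for every spectral measure of B. Second, measurability in t and in
ω is reduced to Poisson integrals by `measurable_of_measurable_lintegral_lorentzian`, and
`measurable_inner_resolvent` carries weak measurability of the resolvent from -i to the whole lower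
half plane. -/

noncomputable section

namespace RankOneAveraging

/-! ### Symmetric operators with everywhere defined resolvents -/

section Operators

variable {H : Type*} [NormedAddCommGroup H] [InnerProductSpace ℂ H]

/-- A symmetric operator `B` such that `B - z` is onto for all non-real `z`. -/
structure IsSymmetricWithResolvents (B : H →ₗ.[ℂ] H) : Prop where
  symm : ∀ x y : B.domain, ⟪B x, (y : H)⟫_ℂ = ⟪(x : H), B y⟫_ℂ
  surj : ∀ z : ℂ, z.im ≠ 0 → ∀ y : H, ∃ x : B.domain, B x - z • (x : H) = y

theorem im_inner_apply_self {B : H →ₗ.[ℂ] H}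
    (hB : ∀ x y : B.domain, ⟪B x, (y : H)⟫_ℂ = ⟪(x : H), B y⟫_ℂ) (x : B.domain) :
    (⟪(x : H), B x⟫_ℂ).im = 0 := by
  have h : starRingEnd ℂ ⟪(x : H), B x⟫_ℂ = ⟪(x : H), B x⟫_ℂ := by
    rw [inner_conj_symm, hB]
  exact Complex.conj_eq_iff_im.mp h

theorem im_inner_sub_smul {B : H →ₗ.[ℂ] H}
    (hB : ∀ x y : B.domain, ⟪B x, (y : H)⟫_ℂ = ⟪(x : H), B y⟫_ℂ) (z : ℂ) (x : B.domain) :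
    (⟪(x : H), B x - z • (x : H)⟫_ℂ).im = -z.im * ‖(x : H)‖ ^ 2 := by
  rw [inner_sub_right, inner_smul_right, Complex.sub_im, im_inner_apply_self hB,
    show ⟪(x : H), (x : H)⟫_ℂ = ((‖(x : H)‖ ^ 2 : ℝ) : ℂ) by
      rw [inner_self_eq_norm_sq_to_K]; norm_cast,
    Complex.mul_im, Complex.ofReal_re, Complex.ofReal_im]
  ring

/-- Cauchy–Schwarz applied to the imaginary part of ⟨x, (B - z)x⟩. This gives injectivity of B - z,
the bound 1/|Im z| on the resolvent, and closedness of the range. -/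
theorem abs_im_mul_norm_le {B : H →ₗ.[ℂ] H}
    (hB : ∀ x y : B.domain, ⟪B x, (y : H)⟫_ℂ = ⟪(x : H), B y⟫_ℂ) (z : ℂ) (x : B.domain) :
    |z.im| * ‖(x : H)‖ ≤ ‖B x - z • (x : H)‖ := by
  rcases (norm_nonneg (x : H)).eq_or_lt with h0 | h0
  · rw [← h0]; simp
  have h1 := im_inner_sub_smul hB z x
  have h2 : |z.im| * ‖(x : H)‖ ^ 2 ≤ ‖(x : H)‖ * ‖B x - z • (x : H)‖ := by
    calc |z.im| * ‖(x : H)‖ ^ 2 = |(⟪(x : H), B x - z • (x : H)⟫_ℂ).im| := by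
          rw [h1, abs_mul, abs_neg, abs_of_nonneg (sq_nonneg ‖(x : H)‖)]
      _ ≤ ‖⟪(x : H), B x - z • (x : H)⟫_ℂ‖ := Complex.abs_im_le_norm _
      _ ≤ _ := norm_inner_le_norm _ _
  nlinarith

theorem sub_smul_injective {B : H →ₗ.[ℂ] H}
    (hB : ∀ x y : B.domain, ⟪B x, (y : H)⟫_ℂ = ⟪(x : H), B y⟫_ℂ) {z : ℂ} (hz : z.im ≠ 0) :
    Function.Injective fun x : B.domain => B x - z • (x : H) := by
  intro x y h
  have h' : B (x - y) - z • ((x - y : B.domain) : H) = 0 := by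
    have h : B x - z • (x : H) = B y - z • (y : H) := h
    rw [LinearPMap.map_sub, Submodule.coe_sub, smul_sub, sub_sub_sub_comm, h, sub_self]
  have h1 := abs_im_mul_norm_le hB z (x - y)
  rw [h', norm_zero] at h1
  have h2 : 0 < |z.im| := abs_pos.mpr hz
  have h3 : ‖((x - y : B.domain) : H)‖ = 0 :=
    le_antisymm (by by_contra hc; push Not at hc; nlinarith [mul_pos h2 hc]) (norm_nonneg _)
  exact sub_eq_zero.mp (Subtype.ext (norm_eq_zero.mp h3))

namespace IsSymmetricWithResolvents

variable {B : H →ₗ.[ℂ] H} (hB : IsSymmetricWithResolvents B)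

include hB

theorem exists_resolvent {z : ℂ} (hz : z.im ≠ 0) : ∃ R : H →L[ℂ] H,
    ‖R‖ ≤ |z.im|⁻¹ ∧ ∀ y, ∃ h : R y ∈ B.domain, B ⟨R y, h⟩ - z • R y = y := by
  let L : B.domain →ₗ[ℂ] H := B.toFun - z • B.domain.subtype
  have hL : Function.Bijective L := ⟨sub_smul_injective hB.symm hz, hB.surj z hz⟩
  let e := LinearEquiv.ofBijective L hL
  have he : ∀ y, B (e.symm y) - z • ((e.symm y : B.domain) : H) = y := fun y =>
    e.apply_symm_apply y
  have hb : ∀ y, ‖(B.domain.subtype ∘ₗ e.symm.toLinearMap) y‖ ≤ |z.im|⁻¹ * ‖y‖ := by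
    intro y
    have h := abs_im_mul_norm_le hB.symm z (e.symm y)
    rw [he] at h
    have h2 : 0 < |z.im| := abs_pos.mpr hz
    rw [inv_mul_eq_div, le_div_iff₀ h2, mul_comm]
    exact h
  exact ⟨LinearMap.mkContinuous _ _ hb, LinearMap.mkContinuous_norm_le _ (by positivity) hb,
    fun y => ⟨(e.symm y).2, he y⟩⟩

theorem resolvent_spec {z : ℂ} (hz : z.im ≠ 0) (y : H) :
    ∃ h : resolvent B z y ∈ B.domain, B ⟨resolvent B z y, h⟩ - z • resolvent B z y = y :=
  ⟨Subtype.coe_prop _, Function.invFun_eq (f := fun x : B.domain => B x - z • (x : H))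
    (hB.surj z hz y)⟩

theorem resolvent_apply_sub_smul {z : ℂ} (hz : z.im ≠ 0) (x : B.domain) :
    resolvent B z (B x - z • (x : H)) = x :=
  congrArg Subtype.val
    (Function.leftInverse_invFun (sub_smul_injective hB.symm hz) x)

theorem resolvent_mem {z : ℂ} (hz : z.im ≠ 0) (y : H) : resolvent B z y ∈ B.domain :=
  (hB.resolvent_spec hz y).1

theorem exists_clm_eq_resolvent {z : ℂ} (hz : z.im ≠ 0) : ∃ R : H →L[ℂ] H,
    ‖R‖ ≤ |z.im|⁻¹ ∧ ∀ y, R y = resolvent B z y := by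
  obtain ⟨R, h1, h2⟩ := hB.exists_resolvent hz
  refine ⟨R, h1, fun y => ?_⟩
  obtain ⟨h, h'⟩ := h2 y
  conv_rhs => rw [← h']
  exact (hB.resolvent_apply_sub_smul hz ⟨R y, h⟩).symm

theorem inner_resolvent_conj {z : ℂ} (hz : z.im ≠ 0) (x y : H) :
    ⟪resolvent B z x, y⟫_ℂ = ⟪x, resolvent B (starRingEnd ℂ z) y⟫_ℂ := by
  have hz' : (starRingEnd ℂ z).im ≠ 0 := by simpa using hz
  obtain ⟨h1, h2⟩ := hB.resolvent_spec hz x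
  obtain ⟨h3, h4⟩ := hB.resolvent_spec hz' y
  conv_lhs => rw [← h4]
  conv_rhs => rw [← h2]
  rw [inner_sub_right, inner_sub_left, inner_smul_left, inner_smul_right,
    ← hB.symm ⟨_, h1⟩ ⟨_, h3⟩]

/-- The first resolvent identity in fixed-point form, ready for Neumann iteration around w. -/
theorem resolvent_eq_resolvent_add {z w : ℂ} (hz : z.im ≠ 0) (hw : w.im ≠ 0) (y : H) :
    resolvent B z y = resolvent B w (y + (z - w) • resolvent B z y) := by
  obtain ⟨h1, h2⟩ := hB.resolvent_spec hz y
  refine (hB.resolvent_apply_sub_smul hw ⟨_, h1⟩).symm.trans (congrArg _ ?_)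
  nth_rewrite 3 [← h2]
  module

theorem im_inner_resolvent {z : ℂ} (hz : z.im ≠ 0) (y : H) :
    (⟪y, resolvent B z y⟫_ℂ).im = z.im * ‖resolvent B z y‖ ^ 2 := by
  obtain ⟨h1, h2⟩ := hB.resolvent_spec hz y
  have h3 := im_inner_sub_smul hB.symm z ⟨_, h1⟩
  simp only [h2] at h3
  rw [← inner_conj_symm, Complex.conj_im, h3]
  ring

end IsSymmetricWithResolvents

/-- The range of B - z is closed, by the lower bound and the closed graph of B. A vector orthogonal
to it is an eigenvector of B* = B for the non-real number z̄, hence zero. -/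
theorem isSymmetricWithResolvents_of_isSelfAdjoint [CompleteSpace H] {B : H →ₗ.[ℂ] H}
    (hB : IsSelfAdjoint B) : IsSymmetricWithResolvents B := by
  have hd : Dense (B.domain : Set H) := hB.dense_domain
  have hadj : B.adjoint = B := hB
  have hsymm : ∀ x y : B.domain, ⟪B x, (y : H)⟫_ℂ = ⟪(x : H), B y⟫_ℂ := by
    have h := LinearPMap.adjoint_isFormalAdjoint (T := B) hd
    rw [hadj] at h
    exact fun x y => h x y
  refine ⟨hsymm, fun z hz => ?_⟩
  let L : B.domain →ₗ[ℂ] H := B.toFun - z • B.domain.subtype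
  have hLx : ∀ x, L x = B x - z • (x : H) := fun x => rfl
  have hclosed : IsClosed (LinearMap.range L : Set H) := by
    refine IsSeqClosed.isClosed fun u y hu huy => ?_
    choose x hx using fun n => LinearMap.mem_range.mp (hu n)
    have hpos : 0 < |z.im| := abs_pos.mpr hz
    have hcx : CauchySeq fun n => (x n : H) := by
      have hcu := huy.cauchySeq
      rw [Metric.cauchySeq_iff] at hcu ⊢
      intro ε hε
      obtain ⟨N, hN⟩ := hcu (|z.im| * ε) (by positivity)
      refine ⟨N, fun m hm n hn => ?_⟩
      have h1 := hN m hm n hn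
      have h2 := abs_im_mul_norm_le hsymm z (x m - x n)
      rw [← hLx, map_sub, hx, hx] at h2
      rw [dist_eq_norm] at h1 ⊢
      exact lt_of_mul_lt_mul_left (h2.trans_lt h1) hpos.le
    obtain ⟨a, ha⟩ := cauchySeq_tendsto_of_complete hcx
    have hBx : Filter.Tendsto (fun n => B (x n)) Filter.atTop (nhds (y + z • a)) := by
      have : (fun n => B (x n)) = fun n => u n + z • (x n : H) := by
        funext n
        rw [← hx n, hLx]
        abel
      rw [this]
      exact huy.add (ha.const_smul z)
    have hg : ((a, y + z • a) : H × H) ∈ B.graph := by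
      have hc : IsClosed (B.graph : Set (H × H)) := hB.isClosed
      refine hc.mem_of_tendsto (ha.prodMk_nhds hBx) (Filter.Eventually.of_forall fun n => ?_)
      exact B.mem_graph (x n)
    obtain ⟨v, hv1, hv2⟩ := B.mem_graph_iff.mp hg
    simp only at hv1 hv2
    exact ⟨v, by rw [hLx, hv1, hv2]; abel⟩
  have hperp : (LinearMap.range L)ᗮ = ⊥ := by
    rw [Submodule.eq_bot_iff]
    intro v hv
    have h1 : ∀ x : B.domain, ⟪starRingEnd ℂ z • v, (x : H)⟫_ℂ = ⟪v, B x⟫_ℂ := by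
      intro x
      have h := (Submodule.mem_orthogonal' _ _).mp hv (L x) ⟨x, rfl⟩
      rw [hLx, inner_sub_right, sub_eq_zero] at h
      rw [h, inner_smul_left, inner_smul_right, Complex.conj_conj]
    have h2 : v ∈ B.adjoint.domain := LinearPMap.mem_adjoint_domain_of_exists v ⟨_, h1⟩
    have h3 := LinearPMap.adjoint_apply_eq hd ⟨v, h2⟩ h1
    have h4 : ∃ h : v ∈ B.domain, B ⟨v, h⟩ = starRingEnd ℂ z • v := by
      rw [hadj] at h2
      refine ⟨h2, ?_⟩
      rw [← h3]
      have h8 := (LinearPMap.ext_iff.mp hadj).2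
      exact (@h8 _ _ _).symm
    obtain ⟨h5, h6⟩ := h4
    have h7 := abs_im_mul_norm_le hsymm (starRingEnd ℂ z) ⟨v, h5⟩
    rw [h6, sub_self, norm_zero] at h7
    have hpos : 0 < |(starRingEnd ℂ z).im| := abs_pos.mpr (by simpa using hz)
    by_contra hne
    have := mul_pos hpos (norm_pos_iff.mpr hne)
    exact absurd h7 (not_le.mpr this)
  have : CompleteSpace (LinearMap.range L) := hclosed.completeSpace_coe
  have htop : LinearMap.range L = ⊤ := (Submodule.orthogonal_eq_bot_iff).mp hperp
  intro y
  have : y ∈ LinearMap.range L := htop ▸ Submodule.mem_top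
  exact this

/-! ### Rank one perturbations -/

section RankOne

variable {A : H →ₗ.[ℂ] H} {φ : H}

theorem rankOnePerturbation_apply (hφ : ‖φ‖ = 1) (t : ℝ) {x : H} (hx : x ∈ A.domain) :
    ∃ h : x ∈ (rankOnePerturbation A φ t).domain,
      rankOnePerturbation A φ t ⟨x, h⟩ = ((t : ℂ) * ⟪φ, x⟫_ℂ) • φ + A ⟨x, hx⟩ := by
  refine ⟨hx, ?_⟩
  change ((t : ℂ) • (ℂ ∙ φ).starProjection : H →L[ℂ] H) x + A ⟨x, hx⟩ = _
  simp [Submodule.starProjection_singleton, hφ, mul_smul]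

/-- The imaginary part is t · Im z · ‖(A - z)⁻¹φ‖². If it vanishes, then t = 0 or (A - z)⁻¹φ = 0,
and the whole expression equals 1. -/
theorem one_add_mul_inner_resolvent_ne_zero (hA : IsSymmetricWithResolvents A)
    (t : ℝ) {z : ℂ} (hz : z.im ≠ 0) : 1 + t * ⟪φ, resolvent A z φ⟫_ℂ ≠ 0 := by
  intro h
  have h1 := congrArg Complex.im h
  have h2 := hA.im_inner_resolvent hz φ
  simp only [Complex.add_im, Complex.one_im, Complex.mul_im, Complex.ofReal_re, Complex.ofReal_im,
    zero_mul, add_zero, zero_add, Complex.zero_im, h2] at h1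
  rcases mul_eq_zero.mp h1 with h3 | h3
  · simp [h3] at h
  rcases mul_eq_zero.mp h3 with h4 | h4
  · exact hz h4
  have h5 : resolvent A z φ = 0 := by simpa using h4
  simp [h5] at h

theorem IsSymmetricWithResolvents.rankOnePerturbation (hA : IsSymmetricWithResolvents A)
    (hφ : ‖φ‖ = 1) (t : ℝ) : IsSymmetricWithResolvents (rankOnePerturbation A φ t) := by
  constructor
  · rintro ⟨x, hx⟩ ⟨y, hy⟩
    have hx' : x ∈ A.domain := hx
    have hy' : y ∈ A.domain := hy
    obtain ⟨_, h1⟩ := rankOnePerturbation_apply hφ t hx'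
    obtain ⟨_, h2⟩ := rankOnePerturbation_apply hφ t hy'
    rw [h1, h2, inner_add_left, inner_add_right, hA.symm ⟨x, hx'⟩ ⟨y, hy'⟩, inner_smul_left,
      inner_smul_right, map_mul, Complex.conj_ofReal, inner_conj_symm]
    ring
  · intro z hz y
    have hD := one_add_mul_inner_resolvent_ne_zero (φ := φ) hA t hz
    set F := ⟪φ, resolvent A z φ⟫_ℂ
    obtain ⟨h1, h2⟩ := hA.resolvent_spec hz y
    obtain ⟨h3, h4⟩ := hA.resolvent_spec hz φ
    -- A preimage is sought in the form (A - z)⁻¹y + c (A - z)⁻¹φ. Applying A + tP_φ - z leaves y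
    -- plus a multiple of φ, and this c makes that multiple zero.
    set c : ℂ := -(t * ⟪φ, resolvent A z y⟫_ℂ) / (1 + t * F) with hc
    have hm : resolvent A z y + c • resolvent A z φ ∈ A.domain :=
      A.domain.add_mem h1 (A.domain.smul_mem c h3)
    obtain ⟨h5, h6⟩ := rankOnePerturbation_apply hφ t hm
    refine ⟨⟨_, h5⟩, ?_⟩
    have h7 : A ⟨_, hm⟩ = A ⟨_, h1⟩ + c • A ⟨_, h3⟩ := by
      rw [← LinearPMap.map_smul, ← LinearPMap.map_add]
      rfl
    rw [h6, h7, sub_eq_iff_eq_add.mp h2, sub_eq_iff_eq_add.mp h4, inner_add_right,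
      inner_smul_right]
    have h8 : t * (⟪φ, resolvent A z y⟫_ℂ + c * F) + c = 0 := by
      rw [hc]; field_simp; ring
    have h9 : ((t : ℂ) * (⟪φ, resolvent A z y⟫_ℂ + c * F)) = -c := by linear_combination h8
    rw [h9]
    module

theorem resolvent_rankOnePerturbation (hA : IsSymmetricWithResolvents A)
    (hφ : ‖φ‖ = 1) (t : ℝ) {z : ℂ} (hz : z.im ≠ 0) :
    resolvent (rankOnePerturbation A φ t) z φ =
      (1 + t * ⟪φ, resolvent A z φ⟫_ℂ)⁻¹ • resolvent A z φ := by
  have hD := one_add_mul_inner_resolvent_ne_zero (φ := φ) hA t hz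
  set F := ⟪φ, resolvent A z φ⟫_ℂ with hF
  obtain ⟨h3, h4⟩ := hA.resolvent_spec hz φ
  have hm : (1 + t * F)⁻¹ • resolvent A z φ ∈ A.domain := A.domain.smul_mem _ h3
  obtain ⟨h5, h6⟩ := rankOnePerturbation_apply hφ t hm
  have h7 : A ⟨_, hm⟩ = (1 + t * F)⁻¹ • A ⟨_, h3⟩ := by
    rw [← LinearPMap.map_smul]
    rfl
  have h8 := (hA.rankOnePerturbation hφ t).resolvent_apply_sub_smul hz ⟨_, h5⟩
  rw [h6, h7, sub_eq_iff_eq_add.mp h4, inner_smul_right] at h8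
  refine Eq.trans (congrArg _ ?_) h8
  have h9 : φ = ((1 + t * F)⁻¹ * (1 + t * F)) • φ := by rw [inv_mul_cancel₀ hD, one_smul]
  conv_lhs => rw [h9]
  module

theorem norm_sq_resolvent_rankOnePerturbation (hA : IsSymmetricWithResolvents A)
    (hφ : ‖φ‖ = 1) (t : ℝ) {z : ℂ} (hz : z.im ≠ 0) :
    ‖resolvent (rankOnePerturbation A φ t) z φ‖ ^ 2 =
      (⟪φ, resolvent A z φ⟫_ℂ).im / z.im / Complex.normSq (1 + t * ⟪φ, resolvent A z φ⟫_ℂ) := by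
  rw [resolvent_rankOnePerturbation hA hφ t hz, norm_smul, mul_pow, norm_inv,
    hA.im_inner_resolvent hz, Complex.normSq_eq_norm_sq]
  field_simp

end RankOne

end Operators

/-! ### The spectral measure of an operator determines the norms of its resolvent -/

namespace ProjectionValuedMeasure

variable {H : Type*} [NormedAddCommGroup H] [InnerProductSpace ℂ H] [CompleteSpace H]
variable (E : ProjectionValuedMeasure H) {S T : Set ℝ}

theorem toFun_toFun_self (hS : MeasurableSet S) (x : H) :
    E.toFun S (E.toFun S x) = E.toFun S x :=
  congrArg (fun T => T x) (E.isStarProjection S hS).isIdempotentElem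

theorem inner_toFun_left (hS : MeasurableSet S) (x y : H) :
    ⟪E.toFun S x, y⟫_ℂ = ⟪x, E.toFun S y⟫_ℂ := by
  rw [← ContinuousLinearMap.adjoint_inner_right, (E.isStarProjection S hS).isSelfAdjoint.adjoint_eq]

theorem inner_toFun_toFun (hS : MeasurableSet S) (x y : H) :
    ⟪E.toFun S x, E.toFun S y⟫_ℂ = ⟪E.toFun S x, y⟫_ℂ := by
  rw [← E.inner_toFun_left hS, E.toFun_toFun_self hS]

theorem norm_toFun_le (hS : MeasurableSet S) (x : H) : ‖E.toFun S x‖ ≤ ‖x‖ := by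
  have h1 := E.inner_eq hS x
  have h2 : (⟪x, E.toFun S x⟫_ℂ).re ≤ ‖x‖ * ‖E.toFun S x‖ :=
    (Complex.re_le_norm _).trans (norm_inner_le_norm _ _)
  rcases (norm_nonneg (E.toFun S x)).eq_or_lt with h | h
  · rw [← h]; positivity
  · nlinarith

theorem toFun_union (hS : MeasurableSet S) (hT : MeasurableSet T) (hd : Disjoint S T) (x : H) :
    E.toFun (S ∪ T) x = E.toFun S x + E.toFun T x := by
  let U : ℕ → Set ℝ := fun n => if n = 0 then S else if n = 1 then T else ∅
  have hU : ∀ n, MeasurableSet (U n) := by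
    intro n
    dsimp only [U]
    split_ifs <;> simp [*]
  have hUd : Pairwise (Function.onFun Disjoint U) := by
    intro i j hij
    dsimp only [Function.onFun, U]
    split_ifs <;> simp_all [disjoint_comm]
  have hUU : ⋃ n, U n = S ∪ T := by
    ext a
    simp only [Set.mem_iUnion, Set.mem_union]
    constructor
    · rintro ⟨n, hn⟩
      dsimp only [U] at hn
      split_ifs at hn
      · exact Or.inl hn
      · exact Or.inr hn
      · exact hn.elim
    · rintro (h | h)
      · exact ⟨0, by simpa [U] using h⟩
      · exact ⟨1, by simpa [U] using h⟩
  have h1 := E.iUnion U hU hUd x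
  rw [hUU] at h1
  have h2 : HasSum (fun n => E.toFun (U n) x) (∑ n ∈ Finset.range 2, E.toFun (U n) x) := by
    refine hasSum_sum_of_ne_finset_zero fun n hn => ?_
    have : 2 ≤ n := not_lt.mp fun h => hn (Finset.mem_range.mpr h)
    have h3 : U n = ∅ := by simp [U, show n ≠ 0 by omega, show n ≠ 1 by omega]
    rw [h3, E.empty_apply]
  rw [h1.unique h2]
  simp [Finset.sum_range_succ, U]

theorem toFun_add_toFun_compl (hS : MeasurableSet S) (x : H) :
    E.toFun S x + E.toFun Sᶜ x = x := by
  rw [← E.toFun_union hS hS.compl disjoint_compl_right, Set.union_compl_self, E.univ]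
  rfl

/-- For y = E(T)x one has ‖E(S ∪ T)y‖² = ‖E(S)y‖² + ‖y‖², while E(S ∪ T) is a contraction. -/
theorem toFun_toFun_of_disjoint (hS : MeasurableSet S) (hT : MeasurableSet T)
    (hd : Disjoint S T) (x : H) : E.toFun S (E.toFun T x) = 0 := by
  have h1 := E.inner_eq (hS.union hT) (E.toFun T x)
  rw [E.toFun_union hS hT hd, inner_add_right, Complex.add_re, E.inner_eq hS, E.inner_eq hT,
    ← E.toFun_union hS hT hd, E.toFun_toFun_self hT] at h1
  have h2 := E.norm_toFun_le (hS.union hT) (E.toFun T x)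
  have h3 : ‖E.toFun S (E.toFun T x)‖ ^ 2 ≤ 0 := by
    nlinarith [norm_nonneg (E.toFun (S ∪ T) (E.toFun T x)), norm_nonneg (E.toFun T x)]
  have h4 : ‖E.toFun S (E.toFun T x)‖ = 0 := by
    nlinarith [norm_nonneg (E.toFun S (E.toFun T x))]
  exact norm_eq_zero.mp h4

theorem toFun_toFun (hS : MeasurableSet S) (hT : MeasurableSet T) (x : H) :
    E.toFun S (E.toFun T x) = E.toFun (S ∩ T) x := by
  have h1 : ∀ y, E.toFun S y = E.toFun (S ∩ T) y + E.toFun (S \ T) y := fun y => by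
    rw [← E.toFun_union (hS.inter hT) (hS.diff hT) (Set.disjoint_sdiff_inter.symm),
      Set.inter_union_sdiff]
  have h2 : E.toFun T x = E.toFun (S ∩ T) x + E.toFun (T \ S) x := by
    rw [← E.toFun_union (hS.inter hT) (hT.diff hS)
      (Set.disjoint_sdiff_right.mono_left Set.inter_subset_left), Set.inter_comm, Set.inter_union_sdiff]
  rw [h1, E.toFun_toFun_of_disjoint (hS.diff hT) hT Set.disjoint_sdiff_left, add_zero, h2, map_add,
    E.toFun_toFun_self (hS.inter hT), E.toFun_toFun_of_disjoint (hS.inter hT) (hT.diff hS)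
      (Set.disjoint_sdiff_right.mono_left Set.inter_subset_left), add_zero]

theorem scalarMeasure_apply_eq_norm (hS : MeasurableSet S) (x : H) :
    E.scalarMeasure x S = ENNReal.ofReal (‖E.toFun S x‖ ^ 2) := by
  rw [E.scalarMeasure_apply x hS, E.inner_eq hS]

theorem scalarMeasure_univ (x : H) : E.scalarMeasure x Set.univ = ENNReal.ofReal (‖x‖ ^ 2) := by
  rw [E.scalarMeasure_apply_eq_norm MeasurableSet.univ, E.univ]
  rfl

instance (x : H) : IsFiniteMeasure (E.scalarMeasure x) :=
  ⟨by rw [scalarMeasure_univ]; exact ENNReal.ofReal_lt_top⟩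

theorem scalarMeasure_real (hS : MeasurableSet S) (x : H) :
    (E.scalarMeasure x).real S = ‖E.toFun S x‖ ^ 2 := by
  rw [Measure.real, E.scalarMeasure_apply_eq_norm hS, ENNReal.toReal_ofReal (by positivity)]

theorem scalarMeasure_toFun (hS : MeasurableSet S) (x : H) :
    E.scalarMeasure (E.toFun S x) = (E.scalarMeasure x).restrict S := by
  ext T hT
  rw [Measure.restrict_apply hT, E.scalarMeasure_apply_eq_norm hT,
    E.scalarMeasure_apply_eq_norm (hT.inter hS), E.toFun_toFun hT hS]

/-- The cross term ⟨E(T)u, E(T)v⟩ vanishes because E(T) commutes with E(S), which fixes u and kills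
v. -/
theorem scalarMeasure_add (hS : MeasurableSet S) {u v : H} (hu : E.toFun S u = u)
    (hv : E.toFun S v = 0) :
    E.scalarMeasure (u + v) = E.scalarMeasure u + E.scalarMeasure v := by
  ext T hT
  rw [Measure.add_apply, E.scalarMeasure_apply_eq_norm hT, E.scalarMeasure_apply_eq_norm hT,
    E.scalarMeasure_apply_eq_norm hT, ← ENNReal.ofReal_add (by positivity) (by positivity)]
  congr 1
  have h : ⟪E.toFun T u, E.toFun T v⟫_ℂ = 0 := by
    rw [E.inner_toFun_left hT, E.toFun_toFun_self hT, ← hu, E.inner_toFun_left hS,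
      E.toFun_toFun hS hT, Set.inter_comm, ← E.toFun_toFun hT hS, hv, map_zero, inner_zero_right]
  rw [map_add, @norm_add_sq ℂ, h]
  simp

/-! ### From the quadratic form of an operator to the norms of its resolvent -/

namespace IsSpectralMeasureOf

variable {E} {B : H →ₗ.[ℂ] H} (hE : E.IsSpectralMeasureOf B)

include hE

theorem mem_domain_of_subset_Icc (hS : MeasurableSet S) {N : ℝ} (hSN : S ⊆ Set.Icc (-N) N) {x : H}
    (hx : E.toFun S x = x) : x ∈ B.domain := by
  rw [hE.1, ← hx, E.scalarMeasure_toFun hS]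
  refine Integrable.of_bound (C := N ^ 2) (by fun_prop) ?_
  filter_upwards [ae_restrict_mem hS] with s hs
  have := hSN hs
  rw [Real.norm_eq_abs, abs_of_nonneg (sq_nonneg s)]
  exact sq_le_sq' this.1 this.2

theorem integrable_sq {x : H} (hx : x ∈ B.domain) :
    Integrable (fun s : ℝ => s ^ 2) (E.scalarMeasure x) := (hE.1 x).mp hx

theorem integrable_id {x : H} (hx : x ∈ B.domain) :
    Integrable (fun s : ℝ => s) (E.scalarMeasure x) := by
  refine ((hE.integrable_sq hx).add (integrable_const (1 : ℝ))).mono' (by fun_prop)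
    (Filter.Eventually.of_forall fun s => ?_)
  rw [Real.norm_eq_abs, abs_le]
  simp only [Pi.add_apply]
  constructor <;> nlinarith [sq_nonneg (s - 1), sq_nonneg (s + 1)]

theorem toFun_mem_domain (hS : MeasurableSet S) {x : H} (hx : x ∈ B.domain) :
    E.toFun S x ∈ B.domain := by
  rw [hE.1, E.scalarMeasure_toFun hS]
  exact (hE.integrable_sq hx).restrict

variable (hB : IsSymmetricWithResolvents B)

include hB

/-- The scalar measures of u and v add up, so the quadratic form of B is additive on u + v and Re⟨u,
Bv⟩ = 0. Replacing v by iv removes the imaginary part. -/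
theorem inner_apply_eq_zero (hS : MeasurableSet S) (u v : B.domain)
    (hu : E.toFun S u = u) (hv : E.toFun S v = 0) : ⟪(u : H), B v⟫_ℂ = 0 := by
  have hre : ∀ v : B.domain, E.toFun S v = 0 → (⟪(u : H), B v⟫_ℂ).re = 0 := by
    intro v hv
    have h1 := hE.2 (u + v)
    rw [Submodule.coe_add, E.scalarMeasure_add hS hu hv,
      integral_add_measure (hE.integrable_id u.2) (hE.integrable_id v.2), LinearPMap.map_add,
      inner_add_left, inner_add_right, inner_add_right, Complex.ofReal_add, ← hE.2, ← hE.2,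
      ← hB.symm v u] at h1
    have h2 := congrArg Complex.re h1
    have h3 : (⟪B v, (u : H)⟫_ℂ).re = (⟪(u : H), B v⟫_ℂ).re := by
      rw [← inner_conj_symm, Complex.conj_re]
    simp only [Complex.add_re, h3] at h2
    linarith
  refine Complex.ext (hre v hv) ?_
  have h := hre (Complex.I • v) (by rw [Submodule.coe_smul, map_smul, hv, smul_zero])
  rw [LinearPMap.map_smul, inner_smul_right, Complex.I_mul_re] at h
  simpa using h

/-- Testing Bu against its own projection v onto Sᶜ ∩ [-n, n] gives ‖v‖² = ⟨u, Bv⟩ = 0. The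
truncation puts v in the domain of B, and n then exhausts the line. -/
theorem toFun_compl_apply_eq_zero (hS : MeasurableSet S) (u : B.domain) (hu : E.toFun S u = u) :
    E.toFun Sᶜ (B u) = 0 := by
  have hI : ∀ n : ℕ, MeasurableSet (Sᶜ ∩ Set.Icc (-(n : ℝ)) n) := fun n =>
    hS.compl.inter measurableSet_Icc
  have h1 : ∀ n : ℕ, E.scalarMeasure (B u) (Sᶜ ∩ Set.Icc (-(n : ℝ)) n) = 0 := by
    intro n
    set v := E.toFun (Sᶜ ∩ Set.Icc (-(n : ℝ)) n) (B u) with hv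
    have hvd : v ∈ B.domain := hE.mem_domain_of_subset_Icc (hI n) (Set.inter_subset_right)
      (E.toFun_toFun_self (hI n) _)
    have hv0 : E.toFun S v = 0 := E.toFun_toFun_of_disjoint hS (hI n)
      (disjoint_compl_right.mono_right Set.inter_subset_left) _
    have h2 := hE.inner_apply_eq_zero hB hS u ⟨v, hvd⟩ hu hv0
    rw [← hB.symm] at h2
    simp only at h2
    rw [hv, ← E.inner_toFun_left (hI n), ← E.inner_toFun_toFun (hI n),
      inner_self_eq_zero] at h2
    rw [E.scalarMeasure_apply_eq_norm (hI n), h2]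
    simp
  have h2 : E.scalarMeasure (B u) Sᶜ = 0 := by
    have h3 : Sᶜ = ⋃ n : ℕ, Sᶜ ∩ Set.Icc (-(n : ℝ)) n := by
      rw [← Set.inter_iUnion]
      refine (Set.inter_eq_left.mpr fun s _ => ?_).symm
      obtain ⟨n, hn⟩ := exists_nat_ge |s|
      exact Set.mem_iUnion.mpr ⟨n, abs_le.mp hn⟩
    rw [h3, measure_iUnion_null_iff]
    exact h1
  rw [E.scalarMeasure_apply_eq_norm hS.compl, ENNReal.ofReal_eq_zero] at h2
  exact norm_eq_zero.mp (by nlinarith [norm_nonneg (E.toFun Sᶜ (B u))])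

theorem apply_toFun (hS : MeasurableSet S) (x : B.domain) :
    B ⟨E.toFun S x, hE.toFun_mem_domain hS x.2⟩ = E.toFun S (B x) := by
  set u : B.domain := ⟨E.toFun S x, hE.toFun_mem_domain hS x.2⟩
  set v : B.domain := ⟨E.toFun Sᶜ x, hE.toFun_mem_domain hS.compl x.2⟩
  have hx : x = u + v := Subtype.ext (E.toFun_add_toFun_compl hS (x : H)).symm
  have h1 := hE.toFun_compl_apply_eq_zero hB hS u (E.toFun_toFun_self hS _)
  have h2 := hE.toFun_compl_apply_eq_zero hB hS.compl v (E.toFun_toFun_self hS.compl _)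
  rw [compl_compl] at h2
  have h3 := E.toFun_add_toFun_compl hS (B u)
  rw [h1, add_zero] at h3
  conv_rhs => rw [hx, LinearPMap.map_add, map_add, h2, add_zero, h3]

theorem re_inner_toFun_apply (hS : MeasurableSet S) (x : B.domain) :
    (⟪E.toFun S (x : H), B x⟫_ℂ).re = ∫ s in S, s ∂E.scalarMeasure (x : H) := by
  rw [← E.inner_toFun_toFun hS, ← hE.apply_toFun hB hS,
    hE.2 ⟨E.toFun S x, hE.toFun_mem_domain hS x.2⟩, Complex.ofReal_re, E.scalarMeasure_toFun hS]

/-- The definition of a spectral measure provides only ∫ s, so ∫ s² is obtained by polarization.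
With w = Bx + Nx, the scalar measures of x + w and x - w differ by 4(s + N) times that of x, and
integrating s against this difference produces ‖Bx‖². -/
theorem norm_sq_apply_of_subset_Icc (hS : MeasurableSet S) {N : ℝ} (hSN : S ⊆ Set.Icc (-N) N)
    (x : B.domain) (hx : E.toFun S x = x) :
    ‖B x‖ ^ 2 = ∫ s, s ^ 2 ∂E.scalarMeasure (x : H) := by
  set ρ := E.scalarMeasure (x : H) with hρ
  -- The shift by N makes the density 4(s + N) nonnegative on [-N, N], so that all terms are
  -- positive measures.
  set w := B x + (N : ℂ) • (x : H) with hw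
  have hSB : E.toFun S (B x) = B x := by
    rw [← hE.apply_toFun hB hS]
    congr 1
    exact Subtype.ext hx
  have hwd : w ∈ B.domain := B.domain.add_mem (hE.mem_domain_of_subset_Icc hS hSN hSB)
    (B.domain.smul_mem _ x.2)
  have hae : ∀ᵐ s ∂ρ, s ∈ Set.Icc (-N) N := by
    rw [hρ, ← hx, E.scalarMeasure_toFun hS]
    exact (ae_restrict_mem hS).mono fun s hs => hSN hs
  have hi1 := hE.integrable_id x.2
  have hi2 := hE.integrable_sq x.2
  have hkey : E.scalarMeasure ((x : H) + w) =
      E.scalarMeasure ((x : H) - w) + ρ.withDensity fun s => ENNReal.ofReal (4 * (s + N)) := by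
    ext T hT
    have h1 : ∫⁻ s in T, ENNReal.ofReal (4 * (s + N)) ∂ρ =
        ENNReal.ofReal (∫ s in T, 4 * (s + N) ∂ρ) := by
      rw [ofReal_integral_eq_lintegral_ofReal]
      · exact ((hi1.add (integrable_const N)).const_mul 4).restrict
      · exact ae_restrict_of_ae (hae.mono fun s hs => by
          have := hs.1
          show 0 ≤ 4 * (s + N)
          linarith)
    have h2 : ∫ s in T, 4 * (s + N) ∂ρ = 4 * (⟪E.toFun T x, w⟫_ℂ).re := by
      rw [integral_const_mul, integral_add hi1.restrict (integrable_const N),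
        ← hE.re_inner_toFun_apply hB hT, hw, inner_add_right, inner_smul_right, Complex.add_re,
        Complex.re_ofReal_mul, ← E.inner_toFun_toFun hT]
      congr 2
      rw [integral_const, ← E.inner_toFun_toFun hT (x : H) (x : H), Measure.real,
        Measure.restrict_apply_univ, ← Measure.real, E.scalarMeasure_real hT]
      rw [show (⟪E.toFun T (x : H), E.toFun T (x : H)⟫_ℂ).re = ‖E.toFun T (x : H)‖ ^ 2 from
        inner_self_eq_norm_sq (𝕜 := ℂ) _, smul_eq_mul, mul_comm]
    have h3 : 0 ≤ ∫ s in T, 4 * (s + N) ∂ρ :=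
      integral_nonneg_of_ae (ae_restrict_of_ae (hae.mono fun s hs => by
          have := hs.1
          show 0 ≤ 4 * (s + N)
          linarith))
    rw [Measure.add_apply, withDensity_apply _ hT, h1, E.scalarMeasure_apply_eq_norm hT,
      E.scalarMeasure_apply_eq_norm hT, ← ENNReal.ofReal_add (by positivity) h3, h2, map_add,
      map_sub, @norm_add_sq ℂ, @norm_sub_sq ℂ, E.inner_toFun_toFun hT]
    congr 1
    simp only [RCLike.re_eq_complex_re]
    ring
  have hplus : (x : H) + w ∈ B.domain := B.domain.add_mem x.2 hwd
  have hminus : (x : H) - w ∈ B.domain := B.domain.sub_mem x.2 hwd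
  have hwx : ⟪(x : H), B ⟨w, hwd⟩⟫_ℂ = ⟪B x, w⟫_ℂ := (hB.symm x ⟨w, hwd⟩).symm
  have hdens : ∫ s, s ∂(ρ.withDensity fun s => ENNReal.ofReal (4 * (s + N))) =
      ∫ s, 4 * (s ^ 2 + N * s) ∂ρ := by
    rw [integral_withDensity_eq_integral_toReal_smul (by fun_prop)
      (Filter.Eventually.of_forall fun _ => ENNReal.ofReal_lt_top)]
    refine integral_congr_ae (hae.mono fun s hs => ?_)
    have := hs.1
    simp only [smul_eq_mul]
    rw [ENNReal.toReal_ofReal (by linarith)]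
    ring
  have hint := congrArg (fun m : Measure ℝ => ∫ s, s ∂m) hkey
  rw [integral_add_measure (hE.integrable_id hminus), hdens] at hint
  · have h4 := congrArg Complex.re (hE.2 ⟨_, hplus⟩)
    have h5 := congrArg Complex.re (hE.2 ⟨_, hminus⟩)
    have h6 : B ⟨_, hplus⟩ = B x + B ⟨w, hwd⟩ := by rw [← LinearPMap.map_add]; rfl
    have h7 : B ⟨_, hminus⟩ = B x - B ⟨w, hwd⟩ := by rw [← LinearPMap.map_sub]; rfl
    simp only [h6, h7, Complex.ofReal_re] at h4 h5
    have h8 := congrArg Complex.re (hE.2 x)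
    rw [Complex.ofReal_re] at h8
    have h9 : (⟪w, B x⟫_ℂ).re = (⟪B x, w⟫_ℂ).re := by rw [← inner_conj_symm, Complex.conj_re]
    have h10 : (⟪B x, w⟫_ℂ).re = ‖B x‖ ^ 2 + N * ∫ s, s ∂ρ := by
      rw [hw, inner_add_right, inner_smul_right, Complex.add_re, Complex.re_ofReal_mul,
        hB.symm, h8]
      congr 1
      exact inner_self_eq_norm_sq (𝕜 := ℂ) _
    rw [inner_add_left, inner_add_right, inner_add_right, hwx] at h4
    rw [inner_sub_left, inner_sub_right, inner_sub_right, hwx] at h5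
    simp only [Complex.add_re, Complex.sub_re] at h4 h5
    rw [integral_const_mul, integral_add hi2 (hi1.const_mul N), integral_const_mul] at hint
    linarith
  · rw [integrable_withDensity_iff_integrable_smul' (by fun_prop)
      (Filter.Eventually.of_forall fun _ => ENNReal.ofReal_lt_top)]
    refine ((hi2.add (hi1.const_mul N)).const_mul 4).congr (hae.mono fun s hs => ?_)
    have := hs.1
    simp only [smul_eq_mul, Pi.add_apply]
    rw [ENNReal.toReal_ofReal (by linarith)]
    ring

/-- Both sides are compared on bounded Borel sets. There E commutes with B, and expanding ‖(B -
z)u‖² reduces the claim to the integrals of 1, s and s². -/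
theorem scalarMeasure_sub_smul (z : ℂ) (x : B.domain) :
    E.scalarMeasure (B x - z • (x : H)) =
      (E.scalarMeasure (x : H)).withDensity fun s => ENNReal.ofReal (Complex.normSq (s - z)) := by
  have hcover : ⋃ n : ℕ, Set.Icc (-(n : ℝ)) n = Set.univ := by
    refine Set.eq_univ_of_forall fun s => ?_
    obtain ⟨n, hn⟩ := exists_nat_ge |s|
    exact Set.mem_iUnion.mpr ⟨n, abs_le.mp hn⟩
  rw [Measure.ext_iff_of_iUnion_eq_univ hcover]
  intro n
  ext T hT
  have hI : MeasurableSet (T ∩ Set.Icc (-(n : ℝ)) n) := hT.inter measurableSet_Icc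
  rw [Measure.restrict_apply hT, Measure.restrict_apply hT, withDensity_apply _ hI,
    E.scalarMeasure_apply_eq_norm hI]
  set I := T ∩ Set.Icc (-(n : ℝ)) n
  set u : B.domain := ⟨E.toFun I x, hE.toFun_mem_domain hI x.2⟩ with hu
  have hi1 := hE.integrable_id u.2
  have hi2 := hE.integrable_sq u.2
  have h1 : E.toFun I (B x - z • (x : H)) = B u - z • (u : H) := by
    rw [map_sub, map_smul, ← hE.apply_toFun hB hI]
  have h2 := hE.norm_sq_apply_of_subset_Icc hB hI Set.inter_subset_right u
    (E.toFun_toFun_self hI _)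
  have h3 : ∀ s : ℝ, Complex.normSq (s - z) = s ^ 2 + (-(2 * z.re) * s + ‖z‖ ^ 2) := by
    intro s
    rw [← Complex.normSq_eq_norm_sq, Complex.normSq_apply, Complex.normSq_apply]
    simp
    ring
  have h4 : ‖(u : H)‖ ^ 2 = ∫ _, (1 : ℝ) ∂E.scalarMeasure (u : H) := by
    rw [integral_const, Measure.real, E.scalarMeasure_univ,
      ENNReal.toReal_ofReal (by positivity), smul_eq_mul, mul_one]
  rw [← E.scalarMeasure_toFun hI, h1, show E.toFun I (x : H) = (u : H) from rfl,
    ← ofReal_integral_eq_lintegral_ofReal]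
  · congr 1
    simp only [h3]
    have hi3 := hi1.const_mul (-(2 * z.re))
    have hi4 : Integrable (fun _ : ℝ => ‖z‖ ^ 2) (E.scalarMeasure (u : H)) := integrable_const _
    have hi5 : Integrable (fun s : ℝ => -(2 * z.re) * s + ‖z‖ ^ 2) (E.scalarMeasure (u : H)) :=
      hi3.add hi4
    rw [integral_add hi2 hi5, integral_add hi3 hi4, integral_const_mul, ← h2,
      @norm_sub_sq ℂ, inner_smul_right, norm_smul, mul_pow, h4, hB.symm, hE.2 u,
      RCLike.re_eq_complex_re, Complex.mul_re, Complex.ofReal_re, Complex.ofReal_im]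
    simp only [integral_const, smul_eq_mul, mul_one]
    ring
  · simp only [h3]
    exact hi2.add ((hi1.const_mul _).add (integrable_const _))
  · exact Filter.Eventually.of_forall fun s => Complex.normSq_nonneg _

/-- With x = (B - z)⁻¹y, the measure of y is |s - z|² times that of x, so the integrand cancels the
density and the total mass ‖x‖² remains. -/
theorem lintegral_inv_normSq_sub {z : ℂ} (hz : z.im ≠ 0) (y : H) :
    ∫⁻ s, ENNReal.ofReal (Complex.normSq (s - z))⁻¹ ∂E.scalarMeasure y =
      ENNReal.ofReal (‖resolvent B z y‖ ^ 2) := by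
  obtain ⟨h1, h2⟩ := hB.resolvent_spec hz y
  have h3 := hE.scalarMeasure_sub_smul hB z ⟨_, h1⟩
  rw [h2] at h3
  have hm : Measurable fun s : ℝ => Complex.normSq (s - z) :=
    Complex.continuous_normSq.measurable.comp (by fun_prop)
  have hm' : Measurable fun s : ℝ => ENNReal.ofReal (Complex.normSq (s - z))⁻¹ :=
    hm.inv.ennreal_ofReal
  rw [h3, lintegral_withDensity_eq_lintegral_mul _ hm.ennreal_ofReal hm',
    ← E.scalarMeasure_univ, ← lintegral_one]
  refine lintegral_congr fun s => ?_
  have h4 : 0 < Complex.normSq (s - z) := by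
    refine Complex.normSq_pos.mpr fun h => hz ?_
    have := congrArg Complex.im h
    simpa using this
  rw [Pi.mul_apply, ← ENNReal.ofReal_mul h4.le, mul_inv_cancel₀ h4.ne', ENNReal.ofReal_one]

end IsSpectralMeasureOf

end ProjectionValuedMeasure

/-! ### Representations of `C(K, ℂ)` and their projection-valued measures -/

section CompactSpace

set_option linter.unusedSectionVars false

variable {K : Type*} [MetricSpace K] [CompactSpace K] [MeasurableSpace K] [BorelSpace K]

theorem integrable_continuousMap {F : Type*} [NormedAddCommGroup F] (m : Measure K)
    [IsFiniteMeasure m] (f : C(K, F)) : Integrable f m := by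
  have h := f.continuous.continuousOn.integrableOn_compact (μ := m) isCompact_univ
  rwa [integrableOn_univ] at h

/-- A real-valued continuous function, seen as a complex-valued one. -/
def complexify (f : C(K, ℝ)) : C(K, ℂ) := (ContinuousMap.mk Complex.ofReal (by fun_prop)).comp f

@[simp]
theorem complexify_apply (f : C(K, ℝ)) (k : K) : complexify f k = (f k : ℂ) := rfl

variable (K) in
/-- The filter of continuous functions `K → [0, 1]` which converge to the indicator of `S` in
`L¹` with respect to all finite measures. -/
def indicatorApprox (S : Set K) : Filter C(K, ℝ) :=
  ⨅ ρ : FiniteMeasure K, Filter.principal {f | ∀ k, f k ∈ Set.Icc (0 : ℝ) 1} ⊓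
    Filter.comap (fun f : C(K, ℝ) => ∫ k, |f k - S.indicator 1 k| ∂(ρ : Measure K)) (nhds 0)

variable {S : Set K}

theorem integrable_abs_sub_indicator (m : Measure K) [IsFiniteMeasure m] (hS : MeasurableSet S)
    (f : C(K, ℝ)) : Integrable (fun k => |f k - S.indicator 1 k|) m :=
  ((integrable_continuousMap m f).sub ((integrable_const (1 : ℝ)).indicator hS)).abs

theorem eventually_indicatorApprox (S : Set K) :
    ∀ᶠ f in indicatorApprox K S, ∀ k, f k ∈ Set.Icc (0 : ℝ) 1 :=
  Filter.mem_iInf_of_mem (0 : FiniteMeasure K) (Filter.mem_inf_of_left (Filter.mem_principal_self _))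

theorem tendsto_indicatorApprox (S : Set K) (m : Measure K) [IsFiniteMeasure m] :
    Filter.Tendsto (fun f : C(K, ℝ) => ∫ k, |f k - S.indicator 1 k| ∂m) (indicatorApprox K S)
      (nhds 0) :=
  Filter.tendsto_comap.mono_left ((iInf_le _ (⟨m, inferInstance⟩ : FiniteMeasure K)).trans
    inf_le_right)

/-- Continuous functions are dense in L¹, and clamping to [0, 1] only decreases the distance to an
indicator. -/
theorem exists_continuousMap_integral_sub_indicator_le (hS : MeasurableSet S) (m : Measure K)
    [IsFiniteMeasure m] {ε : ℝ} (hε : 0 < ε) :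
    ∃ f : C(K, ℝ), (∀ k, f k ∈ Set.Icc (0 : ℝ) 1) ∧ ∫ k, |f k - S.indicator 1 k| ∂m ≤ ε := by
  have hi : Integrable (S.indicator (1 : K → ℝ)) m := (integrable_const (1 : ℝ)).indicator hS
  obtain ⟨g, hg, hgi⟩ := hi.exists_boundedContinuous_integral_sub_le hε
  refine ⟨⟨fun k => max 0 (min 1 (g k)), by fun_prop⟩, fun k => ⟨by simp, by simp⟩, ?_⟩
  refine le_trans (integral_mono (integrable_abs_sub_indicator m hS _) (hi.sub hgi).norm
    fun k => ?_) hg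
  simp only [ContinuousMap.coe_mk, Real.norm_eq_abs, Pi.sub_apply]
  rw [abs_sub_comm (S.indicator 1 k)]
  by_cases hk : k ∈ S
  · simp only [hk, Set.indicator_of_mem, Pi.one_apply]
    rcases le_total 1 (g k) with h | h
    · simp [h]
    · rcases le_total 0 (g k) with h0 | h0
      · simp [h, h0]
      · rw [min_eq_right h, max_eq_left h0, abs_le]
        constructor <;> [rw [abs_of_nonpos (by linarith)]; skip] <;>
        linarith [abs_nonneg (g k - 1)]
  · simp only [hk, Set.indicator_of_notMem, not_false_eq_true, sub_zero]
    rcases le_total 0 (g k) with h0 | h0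
    · rw [max_eq_right (le_min zero_le_one h0), abs_of_nonneg (le_min zero_le_one h0),
        abs_of_nonneg h0]
      exact min_le_right _ _
    · rw [max_eq_left ((min_le_right _ _).trans h0), abs_zero]
      positivity

/-- One filter must serve all finite measures at once, so that the limit operators below are linear
in the vector. The infimum is directed because ρ₁ + ρ₂ controls both ρ₁ and ρ₂. -/
theorem neBot_indicatorApprox (hS : MeasurableSet S) : (indicatorApprox K S).NeBot := by
  refine Filter.iInf_neBot_of_directed' (fun ρ₁ ρ₂ => ⟨ρ₁ + ρ₂, ?_, ?_⟩) fun ρ => ?_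
  · refine le_inf inf_le_left (Filter.tendsto_iff_comap.mp ?_)
    refine squeeze_zero' (Filter.Eventually.of_forall fun f => by positivity)
      (Filter.Eventually.of_forall fun f => ?_)
      (Filter.tendsto_comap.mono_left (inf_le_right (a := Filter.principal _)))
    rw [FiniteMeasure.toMeasure_add, integral_add_measure (integrable_abs_sub_indicator _ hS f)
      (integrable_abs_sub_indicator _ hS f)]
    exact le_add_of_nonneg_right (by positivity)
  · refine le_inf inf_le_left (Filter.tendsto_iff_comap.mp ?_)
    refine squeeze_zero' (Filter.Eventually.of_forall fun f => by positivity)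
      (Filter.Eventually.of_forall fun f => ?_)
      (Filter.tendsto_comap.mono_left (inf_le_right (a := Filter.principal _)))
    rw [FiniteMeasure.toMeasure_add, integral_add_measure (integrable_abs_sub_indicator _ hS f)
      (integrable_abs_sub_indicator _ hS f)]
    exact le_add_of_nonneg_left (by positivity)
  · rw [inf_comm, ← Filter.frequently_mem_iff_neBot, (Metric.nhds_basis_ball.comap _).frequently_iff]
    intro ε hε
    obtain ⟨f, hf, hf'⟩ := exists_continuousMap_integral_sub_indicator_le hS (ρ : Measure K)
      (half_pos hε)
    refine ⟨f, ?_, hf⟩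
    have h0 : 0 ≤ ∫ k, |f k - S.indicator 1 k| ∂(ρ : Measure K) := by positivity
    rw [Set.mem_preimage, mem_ball_zero_iff, Real.norm_eq_abs, abs_of_nonneg h0]
    linarith

theorem tendsto_integral_indicatorApprox (hS : MeasurableSet S) (m : Measure K)
    [IsFiniteMeasure m] :
    Filter.Tendsto (fun f : C(K, ℝ) => ∫ k, f k ∂m) (indicatorApprox K S) (nhds (m.real S)) := by
  rw [tendsto_iff_norm_sub_tendsto_zero]
  refine squeeze_zero' (Filter.Eventually.of_forall fun f => norm_nonneg _)
    (Filter.Eventually.of_forall fun f => ?_) (tendsto_indicatorApprox S m)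
  have hi : Integrable (S.indicator (1 : K → ℝ)) m := (integrable_const (1 : ℝ)).indicator hS
  rw [← integral_indicator_one hS, ← integral_sub (integrable_continuousMap m f) hi]
  exact norm_integral_le_integral_norm _

/-- For values in [0, 1], squaring at most doubles the distance to an indicator. That f and f² have
the same limit is what makes the limit operator idempotent. -/
theorem tendsto_integral_sq_indicatorApprox (hS : MeasurableSet S) (m : Measure K)
    [IsFiniteMeasure m] :
    Filter.Tendsto (fun f : C(K, ℝ) => ∫ k, f k ^ 2 ∂m) (indicatorApprox K S)
      (nhds (m.real S)) := by
  rw [tendsto_iff_norm_sub_tendsto_zero]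
  have h2 := (tendsto_indicatorApprox S m).const_mul 2
  rw [mul_zero] at h2
  refine squeeze_zero' (Filter.Eventually.of_forall fun f => norm_nonneg _)
    ((eventually_indicatorApprox S).mono fun f hf => ?_) h2
  have hi : Integrable (S.indicator (1 : K → ℝ)) m := (integrable_const (1 : ℝ)).indicator hS
  have hf2 : Integrable (fun k => f k ^ 2) m := integrable_continuousMap m (f ^ 2)
  rw [← integral_indicator_one hS, ← integral_sub hf2 hi, ← integral_const_mul]
  refine (norm_integral_le_integral_norm _).trans (integral_mono (hf2.sub hi).norm
    ((integrable_abs_sub_indicator m hS f).const_mul 2) fun k => ?_)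
  have hk := hf k
  simp only [Real.norm_eq_abs]
  by_cases hkS : k ∈ S
  · simp only [hkS, Set.indicator_of_mem, Pi.one_apply]
    rw [show f k ^ 2 - 1 = (f k + 1) * (f k - 1) by ring, abs_mul,
      abs_of_nonneg (by linarith [hk.1] : 0 ≤ f k + 1)]
    exact mul_le_mul_of_nonneg_right (by linarith [hk.2]) (abs_nonneg _)
  · simp only [hkS, Set.indicator_of_notMem, not_false_eq_true, sub_zero]
    rw [abs_of_nonneg (sq_nonneg _), abs_of_nonneg hk.1]
    nlinarith [hk.1, hk.2]

variable {H : Type*} [NormedAddCommGroup H] [InnerProductSpace ℂ H] [CompleteSpace H]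
variable (Φ : C(K, ℂ) →⋆ₐ[ℂ] (H →L[ℂ] H))

theorem inner_map_star_mul (f g : C(K, ℂ)) (x y : H) :
    ⟪x, Φ (star f * g) y⟫_ℂ = ⟪Φ f x, Φ g y⟫_ℂ := by
  rw [map_mul, map_star, mul_apply_eq_comp, ContinuousLinearMap.star_eq_adjoint,
    ContinuousLinearMap.adjoint_inner_right]

theorem star_complexify (f : C(K, ℝ)) : star (complexify f) = complexify f := by
  ext k
  simp

theorem inner_map_complexify (f : C(K, ℝ)) (x y : H) :
    ⟪Φ (complexify f) x, y⟫_ℂ = ⟪x, Φ (complexify f) y⟫_ℂ := by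
  rw [← ContinuousLinearMap.adjoint_inner_right, ← ContinuousLinearMap.star_eq_adjoint, ← map_star,
    star_complexify]

/-- For f ≥ 0 with square root g, ⟨x, Φ(f)x⟩ = ‖Φ(g)x‖² ≥ 0, so the Riesz–Markov–Kakutani theorem
applies. -/
theorem exists_measure_inner_map_eq_integral (x : H) :
    ∃ m : Measure K, IsFiniteMeasure m ∧ ∀ f : C(K, ℂ), ⟪x, Φ f x⟫_ℂ = ∫ k, f k ∂m := by
  let Λ₀ : CompactlySupportedContinuousMap K ℝ →ₗ[ℝ] ℝ :=
    { toFun f := (⟪x, Φ (complexify f.toContinuousMap) x⟫_ℂ).re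
      map_add' f g := by
        have : complexify (f + g).toContinuousMap =
          complexify f.toContinuousMap + complexify g.toContinuousMap := by ext k; simp
        rw [this, map_add, add_apply, inner_add_right, Complex.add_re]
      map_smul' c f := by
        have : complexify (c • f).toContinuousMap =
          (c : ℂ) • complexify f.toContinuousMap := by ext k; simp
        rw [this, map_smul, smul_apply, inner_smul_right,
          Complex.re_ofReal_mul]
        rfl }
  have hΛ : ∀ f, 0 ≤ f → 0 ≤ Λ₀ f := by
    intro f hf
    have hf' : ∀ k, 0 ≤ f k := hf
    let g : C(K, ℝ) := ⟨fun k => Real.sqrt (f k), by fun_prop⟩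
    have h1 : complexify f.toContinuousMap = star (complexify g) * complexify g := by
      rw [star_complexify]
      ext k
      simp only [complexify_apply, ContinuousMap.mul_apply, g, ContinuousMap.coe_mk]
      rw [← Complex.ofReal_mul, Real.mul_self_sqrt (hf' k)]
      rfl
    change 0 ≤ (⟪x, Φ (complexify f.toContinuousMap) x⟫_ℂ).re
    rw [h1, inner_map_star_mul]
    exact inner_self_nonneg (𝕜 := ℂ)
  let Λ := PositiveLinearMap.mk₀ Λ₀ hΛ
  refine ⟨RealRMK.rieszMeasure Λ, inferInstance, fun f => ?_⟩
  set m := RealRMK.rieszMeasure Λ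
  have hreal : ∀ g : C(K, ℝ), ⟪x, Φ (complexify g) x⟫_ℂ = ((∫ k, g k ∂m : ℝ) : ℂ) := by
    intro g
    have h1 : ∫ k, g k ∂m = (⟪x, Φ (complexify g) x⟫_ℂ).re :=
      RealRMK.integral_rieszMeasure Λ (CompactlySupportedContinuousMap.continuousMapEquiv g)
    have h2 : (⟪x, Φ (complexify g) x⟫_ℂ).im = 0 := by
      refine Complex.conj_eq_iff_im.mp ?_
      rw [inner_conj_symm, inner_map_complexify]
    rw [h1]
    exact Complex.ext (by simp) (by simp [h2])
  let g₁ : C(K, ℝ) := ⟨fun k => (f k).re, by fun_prop⟩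
  let g₂ : C(K, ℝ) := ⟨fun k => (f k).im, by fun_prop⟩
  have hf : f = complexify g₁ + Complex.I • complexify g₂ := by
    ext k
    simp only [ContinuousMap.add_apply, ContinuousMap.smul_apply, complexify_apply, smul_eq_mul,
      g₁, g₂, ContinuousMap.coe_mk]
    rw [mul_comm, Complex.re_add_im]
  have hi := integrable_continuousMap m f
  rw [← integral_re_add_im hi]
  conv_lhs => rw [hf]
  rw [map_add, map_smul, add_apply, smul_apply,
    inner_add_right, inner_smul_right, hreal, hreal, mul_comm]
  rfl

/-- The measure `m` on `K` with `⟨x, Φ f x⟩ = ∫ f dm` for all continuous `f`. -/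
def functionalMeasure (x : H) : Measure K := (exists_measure_inner_map_eq_integral Φ x).choose

instance (x : H) : IsFiniteMeasure (functionalMeasure Φ x) :=
  (exists_measure_inner_map_eq_integral Φ x).choose_spec.1

theorem inner_map_eq_integral (x : H) (f : C(K, ℂ)) :
    ⟪x, Φ f x⟫_ℂ = ∫ k, f k ∂functionalMeasure Φ x :=
  (exists_measure_inner_map_eq_integral Φ x).choose_spec.2 f

theorem norm_sq_map (x : H) (f : C(K, ℂ)) :
    ‖Φ f x‖ ^ 2 = ∫ k, ‖f k‖ ^ 2 ∂functionalMeasure Φ x := by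
  have h1 := inner_map_eq_integral Φ x (star f * f)
  rw [inner_map_star_mul] at h1
  have h2 : ∀ k, (star f * f) k = ((‖f k‖ ^ 2 : ℝ) : ℂ) := by
    intro k
    simp [Complex.conj_mul']
  simp only [h2] at h1
  rw [integral_complex_ofReal] at h1
  have h3 := congrArg Complex.re h1
  rw [← inner_self_eq_norm_sq (𝕜 := ℂ)]
  exact h3

theorem functionalMeasure_real_univ (x : H) :
    (functionalMeasure Φ x).real Set.univ = ‖x‖ ^ 2 := by
  have h := norm_sq_map Φ x 1
  simp only [map_one, one_apply_eq_self, ContinuousMap.one_apply, norm_one, one_pow,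
    integral_const, smul_eq_mul, mul_one] at h
  exact h.symm

/-- Two approximants with values in [0, 1] satisfy |f - g|² ≤ |f - g|, so ‖Φ(f)x - Φ(g)x‖² is at
most the sum of their L¹ distances to the indicator. The images form a Cauchy filter. -/
theorem exists_tendsto_map_indicatorApprox (hS : MeasurableSet S) (x : H) :
    ∃ y, Filter.Tendsto (fun f => Φ (complexify f) x) (indicatorApprox K S) (nhds y) := by
  have := neBot_indicatorApprox hS
  set m := functionalMeasure Φ x
  refine cauchy_map_iff_exists_tendsto.mp (cauchy_map_iff.mpr ⟨this, ?_⟩)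
  rw [Metric.uniformity_basis_dist.tendsto_right_iff]
  intro ε hε
  have h0 := tendsto_indicatorApprox S m
  have h1 : ∀ᶠ f in indicatorApprox K S, (∀ k, f k ∈ Set.Icc (0 : ℝ) 1) ∧
      ∫ k, |f k - S.indicator 1 k| ∂m < ε ^ 2 / 2 :=
    (eventually_indicatorApprox S).and (h0.eventually_lt_const (by positivity))
  filter_upwards [h1.prod_mk h1] with p hp
  obtain ⟨⟨hf, hf'⟩, ⟨hg, hg'⟩⟩ := hp
  set f := p.1
  set g := p.2
  have hif := integrable_abs_sub_indicator m hS f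
  have hig := integrable_abs_sub_indicator m hS g
  have h2 : dist (Φ (complexify f) x) (Φ (complexify g) x) ^ 2 < ε ^ 2 := by
    rw [dist_eq_norm, ← sub_apply, ← map_sub, norm_sq_map]
    calc ∫ k, ‖(complexify f - complexify g) k‖ ^ 2 ∂m
        ≤ ∫ k, |f k - S.indicator 1 k| + |g k - S.indicator 1 k| ∂m := by
          refine integral_mono ?_ (hif.add hig) fun k => ?_
          · exact integrable_continuousMap m
              ⟨fun k => ‖(complexify f - complexify g) k‖ ^ 2, by fun_prop⟩
          · have hfk := hf k
            have hgk := hg k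
            simp only [ContinuousMap.sub_apply, complexify_apply, ← Complex.ofReal_sub,
              Complex.norm_real, Real.norm_eq_abs]
            have h3 : |f k - g k| ≤ |f k - S.indicator 1 k| + |g k - S.indicator 1 k| := by
              rw [abs_sub_comm (g k)]
              exact abs_sub_le _ _ _
            have h4 : |f k - g k| ≤ 1 := by
              rw [abs_le]
              constructor <;> linarith [hfk.1, hfk.2, hgk.1, hgk.2]
            nlinarith [abs_nonneg (f k - g k)]
      _ = ∫ k, |f k - S.indicator 1 k| ∂m + ∫ k, |g k - S.indicator 1 k| ∂m :=
          integral_add hif hig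
      _ < ε ^ 2 := by linarith
  exact lt_of_pow_lt_pow_left₀ 2 hε.le h2

theorem eq_of_forall_inner_self_eq {P Q : H →L[ℂ] H} (h : ∀ x, ⟪x, P x⟫_ℂ = ⟪x, Q x⟫_ℂ) :
    P = Q := by
  have h1 : (((P - Q : H →L[ℂ] H)) : H →ₗ[ℂ] H) = 0 := by
    rw [← inner_map_self_eq_zero]
    intro x
    rw [← inner_conj_symm]
    simp [inner_sub_right, h]
  rw [← sub_eq_zero]
  ext x
  exact LinearMap.congr_fun h1 x

theorem exists_isStarProjection_inner_eq (hS : MeasurableSet S) :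
    ∃ P : H →L[ℂ] H, IsStarProjection P ∧
      ∀ x, ⟪x, P x⟫_ℂ = ((functionalMeasure Φ x).real S : ℂ) := by
  have hne := neBot_indicatorApprox hS
  choose T hT using exists_tendsto_map_indicatorApprox Φ hS
  let T₀ : H →ₗ[ℂ] H := linearMapOfTendsto T
    (fun f => ((Φ (complexify f) : H →L[ℂ] H) : H →ₗ[ℂ] H)) (tendsto_pi_nhds.mpr hT)
  have hnorm : ∀ x, ‖T x‖ ^ 2 = (functionalMeasure Φ x).real S := by
    intro x
    refine tendsto_nhds_unique ((hT x).norm.pow 2) ?_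
    have h := tendsto_integral_sq_indicatorApprox hS (functionalMeasure Φ x)
    refine h.congr fun f => ?_
    rw [norm_sq_map]
    simp
  have hinner : ∀ x, ⟪x, T x⟫_ℂ = ((functionalMeasure Φ x).real S : ℂ) := by
    intro x
    refine tendsto_nhds_unique (tendsto_const_nhds.inner (hT x)) ?_
    have h := tendsto_integral_indicatorApprox hS (functionalMeasure Φ x)
    refine (Complex.continuous_ofReal.tendsto _ |>.comp h).congr fun f => ?_
    rw [inner_map_eq_integral]
    simp only [complexify_apply, Function.comp_apply]
    exact integral_ofReal.symm
  have hsymm : ∀ x y, ⟪T x, y⟫_ℂ = ⟪x, T y⟫_ℂ := by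
    intro x y
    refine tendsto_nhds_unique ((hT x).inner tendsto_const_nhds) ?_
    exact (tendsto_const_nhds.inner (hT y)).congr fun f => (inner_map_complexify Φ f x y).symm
  have hbound : ∀ x, ‖T₀ x‖ ≤ 1 * ‖x‖ := by
    intro x
    rw [one_mul]
    refine le_of_sq_le_sq ?_ (norm_nonneg x)
    rw [show T₀ x = T x from rfl, hnorm, ← functionalMeasure_real_univ Φ x]
    exact measureReal_mono (Set.subset_univ S)
  let P : H →L[ℂ] H := T₀.mkContinuous 1 hbound
  have hP : ∀ x, P x = T x := fun x => rfl
  refine ⟨P, ⟨?_, ?_⟩, hinner⟩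
  -- Idempotence in terms of forms: ⟨x, TTx⟩ = ‖Tx‖² = m(S) = ⟨x, Tx⟩, where m is the measure of x.
  · refine eq_of_forall_inner_self_eq fun x => ?_
    rw [mul_apply_eq_comp, hP, hP, ← hsymm, inner_self_eq_norm_sq_to_K, hinner]
    rw [← hnorm]
    norm_cast
  · rw [ContinuousLinearMap.isSelfAdjoint_iff_isSymmetric]
    exact hsymm

end CompactSpace

/-- A family of projections indexed by the Borel sets of the line, whose quadratic forms are
measures with total mass `‖x‖²`, is a projection-valued measure. -/
theorem exists_projectionValuedMeasure {H : Type*} [NormedAddCommGroup H]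
    [InnerProductSpace ℂ H] [CompleteSpace H] (n : H → Measure ℝ) [∀ x, IsFiniteMeasure (n x)]
    (hn : ∀ x, (n x).real Set.univ = ‖x‖ ^ 2)
    (hP : ∀ S, MeasurableSet S → ∃ P : H →L[ℂ] H, IsStarProjection P ∧
      ∀ x, ⟪x, P x⟫_ℂ = ((n x).real S : ℂ)) :
    ∃ E : ProjectionValuedMeasure H, ∀ x, E.scalarMeasure x = n x := by
  classical
  choose! P hPs hPn using hP
  have hnorm : ∀ S, MeasurableSet S → ∀ x, ‖P S x‖ ^ 2 = (n x).real S := by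
    intro S hS x
    have h1 : ⟪P S x, P S x⟫_ℂ = ⟪x, P S x⟫_ℂ := by
      rw [← ContinuousLinearMap.adjoint_inner_right, (hPs S hS).isSelfAdjoint.adjoint_eq]
      exact congrArg (fun T : H →L[ℂ] H => ⟪x, T x⟫_ℂ) (hPs S hS).isIdempotentElem
    rw [hPn S hS] at h1
    rw [← inner_self_eq_norm_sq (𝕜 := ℂ), h1]
    simp
  let E : ProjectionValuedMeasure H :=
    { toFun := fun S => if MeasurableSet S then P S else 0
      isStarProjection := fun S hS => by
        rw [if_pos hS]
        exact hPs S hS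
      not_measurable := fun S hS => if_neg hS
      univ := by
        rw [if_pos MeasurableSet.univ]
        refine eq_of_forall_inner_self_eq fun x => ?_
        rw [hPn _ MeasurableSet.univ, hn, one_apply_eq_self,
          inner_self_eq_norm_sq_to_K]
        norm_cast
      iUnion := fun S hS hd x => by
        have hU := MeasurableSet.iUnion hS
        simp only [hS, hU, if_true]
        -- The remainder of a partial sum is the projection of the remaining set. Its squared norm
        -- at x is a tail of the scalar measure, so scalar additivity implies strong additivity.
        have hdiff : ∀ F : Finset ℕ, P (⋃ i, S i) - ∑ i ∈ F, P (S i) =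
            P ((⋃ i, S i) \ ⋃ i ∈ F, S i) := by
          intro F
          have hF : MeasurableSet (⋃ i ∈ F, S i) := F.measurableSet_biUnion fun i _ => hS i
          refine eq_of_forall_inner_self_eq fun y => ?_
          rw [sub_apply, sum_apply, inner_sub_right,
            inner_sum, hPn _ hU, hPn _ (hU.diff hF),
            measureReal_sdiff (Set.iUnion₂_subset fun i _ => Set.subset_iUnion S i) hF,
            measureReal_biUnion_finset (fun i _ j _ hij => hd hij) fun i _ => hS i]
          simp [hPn _ (hS _)]
        have hsum : HasSum (fun i => (n x).real (S i)) ((n x).real (⋃ i, S i)) := by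
          have h := measure_iUnion (μ := n x) hd hS
          have h' : HasSum (fun i => n x (S i)) (n x (⋃ i, S i)) := by
            rw [h]
            exact ENNReal.summable.hasSum
          rw [Measure.real, h, ENNReal.tsum_toReal_eq fun i => measure_ne_top _ _]
          refine (ENNReal.summable_toReal ?_).hasSum
          rw [← h]
          exact measure_ne_top _ _
        rw [HasSum, tendsto_iff_norm_sub_tendsto_zero]
        have h1 : Filter.Tendsto (fun F : Finset ℕ => (n x).real (⋃ i, S i) -
            ∑ i ∈ F, (n x).real (S i)) (SummationFilter.unconditional ℕ).filter (nhds 0) := by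
          have := hsum.const_sub ((n x).real (⋃ i, S i))
          rwa [sub_self] at this
        have h2 := h1.sqrt
        rw [Real.sqrt_zero] at h2
        refine h2.congr fun F => ?_
        have hF : MeasurableSet (⋃ i ∈ F, S i) := F.measurableSet_biUnion fun i _ => hS i
        rw [norm_sub_rev, ← sum_apply, ← sub_apply, hdiff,
          ← Real.sqrt_sq (norm_nonneg _), hnorm _ (hU.diff hF),
          measureReal_sdiff (Set.iUnion₂_subset fun i _ => Set.subset_iUnion S i) hF,
          measureReal_biUnion_finset (fun i _ j _ hij => hd hij) fun i _ => hS i] }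
  refine ⟨E, fun x => ?_⟩
  ext S hS
  rw [E.scalarMeasure_apply_eq_norm hS]
  have : E.toFun S = P S := if_pos hS
  rw [this, hnorm S hS, Measure.real, ENNReal.ofReal_toReal (measure_ne_top _ _)]

/-! ### The spectral theorem -/

section CompactSpace

variable {K : Type*} [MetricSpace K] [CompactSpace K] [MeasurableSpace K] [BorelSpace K]
variable {H : Type*} [NormedAddCommGroup H] [InnerProductSpace ℂ H] [CompleteSpace H]
variable (Φ : C(K, ℂ) →⋆ₐ[ℂ] (H →L[ℂ] H))

omit [CompactSpace K] in
theorem measurable_ofReal_normSq (f : C(K, ℂ)) :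
    Measurable fun k => ENNReal.ofReal (Complex.normSq (f k)) :=
  (Complex.continuous_normSq.measurable.comp f.continuous.measurable).ennreal_ofReal

theorem functionalMeasure_map (f : C(K, ℂ)) (x : H) :
    functionalMeasure Φ (Φ f x) =
      (functionalMeasure Φ x).withDensity fun k => ENNReal.ofReal (Complex.normSq (f k)) := by
  let w : C(K, ℝ) := ⟨fun k => Complex.normSq (f k), by fun_prop⟩
  have hw : Integrable (fun k => Complex.normSq (f k)) (functionalMeasure Φ x) :=
    integrable_continuousMap _ w
  have := isFiniteMeasure_withDensity_ofReal hw.2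
  refine ext_of_forall_integral_eq_of_IsFiniteMeasure fun h => ?_
  set c := complexify h.toContinuousMap
  have h1 := inner_map_eq_integral Φ (Φ f x) c
  rw [← mul_apply_eq_comp, ← map_mul, ← inner_map_star_mul, inner_map_eq_integral] at h1
  have h2 : ∀ k, (star f * (c * f)) k = ((Complex.normSq (f k) * h k : ℝ) : ℂ) := by
    intro k
    rw [Complex.ofReal_mul, Complex.normSq_eq_conj_mul_self]
    simp only [ContinuousMap.mul_apply, ContinuousMap.star_apply, c, complexify_apply]
    exact (mul_assoc _ _ _).symm.trans (mul_right_comm _ _ _)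
  simp only [h2] at h1
  rw [integral_complex_ofReal, show ∫ k, c k ∂functionalMeasure Φ (Φ f x) =
    ((∫ k, h k ∂functionalMeasure Φ (Φ f x) : ℝ) : ℂ) from integral_complex_ofReal,
    Complex.ofReal_inj] at h1
  rw [integral_withDensity_eq_integral_toReal_smul (measurable_ofReal_normSq f)
    (Filter.Eventually.of_forall fun _ => ENNReal.ofReal_lt_top), ← h1]
  refine integral_congr_ae (Filter.Eventually.of_forall fun k => ?_)
  simp only [smul_eq_mul]
  rw [ENNReal.toReal_ofReal (Complex.normSq_nonneg _)]

/-- Dominated convergence in L² of the measure of x, transported by the isometry `norm_sq_map`. It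
gives access to discontinuous and unbounded functions of the operator. -/
theorem exists_tendsto_map_of_dominated (x : H) (f : ℕ → C(K, ℂ)) (g : K → ℂ) (G : K → ℝ)
    (hG : Integrable (fun k => G k ^ 2) (functionalMeasure Φ x))
    (hfG : ∀ n, ∀ᵐ k ∂functionalMeasure Φ x, ‖f n k‖ ≤ G k)
    (hfg : ∀ᵐ k ∂functionalMeasure Φ x,
      Filter.Tendsto (fun n => f n k) Filter.atTop (nhds (g k))) :
    ∃ y, Filter.Tendsto (fun n => Φ (f n) x) Filter.atTop (nhds y) ∧
      ‖y‖ ^ 2 = ∫ k, ‖g k‖ ^ 2 ∂functionalMeasure Φ x := by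
  set m := functionalMeasure Φ x
  have hcauchy : CauchySeq fun n => Φ (f n) x := by
    rw [cauchySeq_iff_tendsto_dist_atTop_0]
    have h1 : Filter.Tendsto (fun p : ℕ × ℕ => ∫ k, ‖(f p.1 - f p.2) k‖ ^ 2 ∂m) Filter.atTop
        (nhds (∫ _, (0 : ℝ) ∂m)) := by
      refine tendsto_integral_filter_of_dominated_convergence (fun k => 4 * G k ^ 2)
        (Filter.Eventually.of_forall fun p => ?_) (Filter.Eventually.of_forall fun p => ?_)
        (hG.const_mul 4) ?_
      · exact (integrable_continuousMap m
          ⟨fun k => ‖(f p.1 - f p.2) k‖ ^ 2, by fun_prop⟩).aestronglyMeasurable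
      · filter_upwards [hfG p.1, hfG p.2] with k h1 h2
        have h3 : ‖(f p.1 - f p.2) k‖ ≤ 2 * G k := (norm_sub_le _ _).trans (by linarith)
        rw [Real.norm_eq_abs, abs_of_nonneg (by positivity)]
        nlinarith [norm_nonneg ((f p.1 - f p.2) k)]
      · filter_upwards [hfg] with k hk
        have h2 : Filter.Tendsto (fun p : ℕ × ℕ => f p.1 k - f p.2 k) Filter.atTop
            (nhds (g k - g k)) := by
          rw [← Filter.prod_atTop_atTop_eq]
          exact (hk.comp Filter.tendsto_fst).sub (hk.comp Filter.tendsto_snd)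
        have h3 := h2.norm.pow 2
        rw [sub_self, norm_zero, zero_pow two_ne_zero] at h3
        exact h3
    rw [integral_zero] at h1
    have h2 := h1.sqrt
    rw [Real.sqrt_zero] at h2
    refine h2.congr fun p => ?_
    rw [← norm_sq_map, Real.sqrt_sq (norm_nonneg _), map_sub, sub_apply, dist_eq_norm]
  obtain ⟨y, hy⟩ := cauchySeq_tendsto_of_complete hcauchy
  refine ⟨y, hy, tendsto_nhds_unique (hy.norm.pow 2) ?_⟩
  simp only [norm_sq_map]
  refine tendsto_integral_of_dominated_convergence (fun k => G k ^ 2) (fun n => ?_) hG (fun n => ?_)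
    ?_
  · exact (integrable_continuousMap m ⟨fun k => ‖f n k‖ ^ 2, by fun_prop⟩).aestronglyMeasurable
  · filter_upwards [hfG n] with k h1
    rw [Real.norm_eq_abs, abs_of_nonneg (by positivity)]
    exact pow_le_pow_left₀ (norm_nonneg _) h1 2
  · filter_upwards [hfg] with k hk
    exact hk.norm.pow 2

/-! ### Recovering B from a symbol e of (B + i)⁻¹: e plays the role of 1/(s + i), so s = Re(1/e) -/

variable {B : H →ₗ.[ℂ] H} (hB : IsSymmetricWithResolvents B) (e : C(K, ℂ))
  (he : ∀ y, Φ e y = resolvent B (-Complex.I) y)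

include hB he

/-- The resolvent identity between i and -i says ē - e = 2i e ē almost everywhere. Where e ≠ 0, this
means that Im(1/e) = 1. -/
theorem ae_normSq_eq_neg_im (x : H) :
    ∀ᵐ k ∂functionalMeasure Φ x, Complex.normSq (e k) = -(e k).im := by
  have hI : (-Complex.I).im ≠ 0 := by simp
  have hI' : Complex.I.im ≠ 0 := by simp
  have hstar : ∀ y, Φ (star e) y = resolvent B Complex.I y := by
    intro y
    refine ext_inner_left ℂ fun v => ?_
    have h := hB.inner_resolvent_conj hI v y
    rw [map_neg, Complex.conj_I, neg_neg] at h
    rw [← h, ← he, map_star, ContinuousLinearMap.star_eq_adjoint,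
      ContinuousLinearMap.adjoint_inner_right]
  set g : C(K, ℂ) := star e - e - (2 * Complex.I) • (e * star e)
  have hg : Φ g x = 0 := by
    have h1 := hB.resolvent_eq_resolvent_add hI' hI x
    rw [← hstar, ← he, map_add, map_smul] at h1
    rw [map_sub, map_sub, map_smul, map_mul, sub_apply, sub_apply, smul_apply, mul_apply_eq_comp]
    nth_rewrite 1 [h1]
    module
  have h2 := norm_sq_map Φ x g
  rw [hg, norm_zero, zero_pow two_ne_zero] at h2
  have h3 := (integral_eq_zero_iff_of_nonneg (fun k => sq_nonneg _)
    (integrable_continuousMap _ ⟨fun k => ‖g k‖ ^ 2, by fun_prop⟩)).mp h2.symm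
  filter_upwards [h3] with k hk
  have h4 : g k = 0 := by simpa using hk
  have h5 := congrArg Complex.im h4
  simp [g] at h5
  rw [Complex.normSq_apply]
  linarith

/-- The functions a / (|e|² + a) tend to the indicator of {e = 0} as a → 0, and their products with
e tend to 0. The limit vector y then satisfies (B + i)⁻¹y = 0, so y = 0, and ‖y‖² is the measure of
{e = 0}. -/
theorem ae_functionalMeasure_ne_zero (x : H) :
    ∀ᵐ k ∂functionalMeasure Φ x, e k ≠ 0 := by
  classical
  set m := functionalMeasure Φ x
  have hI : (-Complex.I).im ≠ 0 := by simp
  let a : ℕ → ℝ := fun n => 1 / ((n : ℝ) + 1)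
  have ha : ∀ n, 0 < a n := fun n => by positivity
  have halim : Filter.Tendsto a Filter.atTop (nhds 0) := tendsto_one_div_add_atTop_nhds_zero_nat
  have hpos : ∀ n k, 0 < Complex.normSq (e k) + a n := fun n k =>
    add_pos_of_nonneg_of_pos (Complex.normSq_nonneg _) (ha n)
  let f : ℕ → C(K, ℂ) := fun n => complexify
    ⟨fun k => a n / (Complex.normSq (e k) + a n),
      continuous_const.div (by fun_prop) fun k => (hpos n k).ne'⟩
  have hf1 : ∀ n k, ‖f n k‖ ≤ 1 := by
    intro n k
    simp only [f, complexify_apply, ContinuousMap.coe_mk, Complex.norm_real]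
    rw [Real.norm_eq_abs, abs_of_nonneg (div_nonneg (ha n).le (hpos n k).le), div_le_one (hpos n k)]
    linarith [Complex.normSq_nonneg (e k)]
  have hflim : ∀ k, Filter.Tendsto (fun n => f n k) Filter.atTop
      (nhds (if e k = 0 then 1 else 0)) := by
    intro k
    split_ifs with hk
    · refine tendsto_const_nhds.congr fun n => ?_
      simp [f, hk, (ha n).ne']
    · have h1 : Filter.Tendsto (fun n => a n / (Complex.normSq (e k) + a n)) Filter.atTop
          (nhds (0 / (Complex.normSq (e k) + 0))) :=
        halim.div (halim.const_add _) (by simpa using hk)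
      rw [zero_div] at h1
      exact (Complex.continuous_ofReal.tendsto _).comp h1
  obtain ⟨y, hy, hy'⟩ := exists_tendsto_map_of_dominated Φ x f (fun k => if e k = 0 then 1 else 0)
    (fun _ => 1) (integrable_const _) (fun n => Filter.Eventually.of_forall (hf1 n))
    (Filter.Eventually.of_forall hflim)
  obtain ⟨z, hz, hz'⟩ := exists_tendsto_map_of_dominated Φ x (fun n => e * f n) (fun _ => 0)
    (fun k => ‖e k‖) (integrable_continuousMap _ ⟨fun k => ‖e k‖ ^ 2, by fun_prop⟩)
    (fun n => Filter.Eventually.of_forall fun k => by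
      rw [ContinuousMap.mul_apply, norm_mul]
      exact mul_le_of_le_one_right (norm_nonneg _) (hf1 n k))
    (Filter.Eventually.of_forall fun k => by
      have h1 := (hflim k).const_mul (e k)
      have h2 : e k * (if e k = 0 then 1 else 0) = 0 := by split_ifs with h <;> simp [h]
      rw [h2] at h1
      exact h1)
  have hz0 : z = 0 := by simpa using hz'
  have h1 : Φ e y = z := by
    refine tendsto_nhds_unique (((Φ e).continuous.tendsto y).comp hy) (hz.congr fun n => ?_)
    rw [map_mul]
    rfl
  have hy0 : y = 0 := by
    rw [he, hz0] at h1
    obtain ⟨h2, h3⟩ := hB.resolvent_spec hI y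
    have h4 : (⟨resolvent B (-Complex.I) y, h2⟩ : B.domain) = 0 := Subtype.ext h1
    rw [h4, LinearPMap.map_zero, h1, smul_zero, sub_zero] at h3
    exact h3.symm
  rw [hy0, norm_zero, zero_pow two_ne_zero] at hy'
  have hmeas : MeasurableSet {k | e k = 0} := (isClosed_eq e.continuous continuous_const).measurableSet
  have h5 : (fun k => ‖(if e k = 0 then 1 else 0 : ℂ)‖ ^ 2) = {k | e k = 0}.indicator 1 := by
    funext k
    by_cases hk : e k = 0 <;> simp [Set.indicator, hk]
  rw [h5, integral_indicator_one hmeas] at hy'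
  rw [ae_iff]
  simp only [not_not]
  exact (measureReal_eq_zero_iff).mp hy'.symm

/-- The domain is the range of Φ(e). If x = Φ(e)y, the measure of x has density |e|² against that of
y, and |e|² (Re 1/e)² ≤ 1. Conversely, |1/e|² = (Re 1/e)² + 1 almost everywhere, so ē / (|e|² + a)
converges in L² to 1/e and yields y with Φ(e)y = x. -/
theorem integrable_sq_re_inv_iff_mem_domain (x : H) :
    x ∈ B.domain ↔ Integrable (fun k => (e k)⁻¹.re ^ 2) (functionalMeasure Φ x) := by
  have hI : (-Complex.I).im ≠ 0 := by simp
  have hmeas : Measurable fun k => (e k)⁻¹.re :=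
    Complex.measurable_re.comp e.continuous.measurable.inv
  constructor
  · intro hx
    obtain ⟨y, rfl⟩ : ∃ y, Φ e y = x := ⟨B ⟨x, hx⟩ - (-Complex.I) • x, by
      rw [he]
      exact hB.resolvent_apply_sub_smul hI ⟨x, hx⟩⟩
    rw [functionalMeasure_map, integrable_withDensity_iff_integrable_smul'
      (measurable_ofReal_normSq e)
      (Filter.Eventually.of_forall fun _ => ENNReal.ofReal_lt_top)]
    refine Integrable.of_bound (C := 1) ?_ (Filter.Eventually.of_forall fun k => ?_)
    · exact ((measurable_ofReal_normSq e).ennreal_toReal.smul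
          (hmeas.pow_const 2)).aestronglyMeasurable
    · rw [ENNReal.toReal_ofReal (Complex.normSq_nonneg _), smul_eq_mul, Real.norm_eq_abs,
        abs_of_nonneg (mul_nonneg (Complex.normSq_nonneg _) (sq_nonneg _))]
      have h1 : (e k)⁻¹.re ^ 2 ≤ Complex.normSq (e k)⁻¹ := by
        rw [Complex.normSq_apply]
        nlinarith [sq_nonneg (e k)⁻¹.im]
      calc Complex.normSq (e k) * (e k)⁻¹.re ^ 2
          ≤ Complex.normSq (e k) * Complex.normSq (e k)⁻¹ :=
            mul_le_mul_of_nonneg_left h1 (Complex.normSq_nonneg _)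
        _ ≤ 1 := by
            rw [Complex.normSq_inv]
            exact mul_inv_le_one
  · intro hx
    have h0 := ae_functionalMeasure_ne_zero Φ hB e he x
    have hsq : ∀ᵐ k ∂functionalMeasure Φ x, ‖e k‖⁻¹ ^ 2 = (e k)⁻¹.re ^ 2 + 1 := by
      filter_upwards [h0, ae_normSq_eq_neg_im Φ hB e he x] with k hk hk'
      have h1 : Complex.normSq (e k) ≠ 0 := by simpa using hk
      rw [← norm_inv, ← Complex.normSq_eq_norm_sq, Complex.normSq_apply, ← sq, ← sq]
      congr 1
      rw [Complex.inv_im, ← hk', div_self h1, one_pow]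
    have hG : Integrable (fun k => ‖e k‖⁻¹ ^ 2) (functionalMeasure Φ x) :=
      (hx.add (integrable_const (1 : ℝ))).congr (hsq.mono fun k hk => hk.symm)
    let a : ℕ → ℝ := fun n => 1 / ((n : ℝ) + 1)
    have ha : ∀ n, 0 < a n := fun n => by positivity
    have halim : Filter.Tendsto a Filter.atTop (nhds 0) := tendsto_one_div_add_atTop_nhds_zero_nat
    have hpos : ∀ n k, 0 < Complex.normSq (e k) + a n := fun n k =>
      add_pos_of_nonneg_of_pos (Complex.normSq_nonneg _) (ha n)
    let f : ℕ → C(K, ℂ) := fun n => star e * complexify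
      ⟨fun k => (Complex.normSq (e k) + a n)⁻¹,
        Continuous.inv₀ (by fun_prop) fun k => (hpos n k).ne'⟩
    have hef : ∀ n k, e k * f n k =
        ((Complex.normSq (e k) / (Complex.normSq (e k) + a n) : ℝ) : ℂ) := by
      intro n k
      simp only [f, ContinuousMap.mul_apply, complexify_apply, ContinuousMap.coe_mk]
      rw [← mul_assoc, show e k * (star e) k = (Complex.normSq (e k) : ℂ) from
        Complex.mul_conj (e k), ← Complex.ofReal_mul, div_eq_mul_inv]
    have hefle : ∀ n k, ‖e k * f n k‖ ≤ 1 := by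
      intro n k
      rw [hef, Complex.norm_real, Real.norm_eq_abs,
        abs_of_nonneg (div_nonneg (Complex.normSq_nonneg _) (hpos n k).le), div_le_one (hpos n k)]
      linarith [ha n]
    have heflim : ∀ k, e k ≠ 0 →
        Filter.Tendsto (fun n => e k * f n k) Filter.atTop (nhds 1) := by
      intro k hk
      have h1 : Complex.normSq (e k) ≠ 0 := by simpa using hk
      have h2 : Filter.Tendsto (fun n => Complex.normSq (e k) / (Complex.normSq (e k) + a n))
          Filter.atTop (nhds (Complex.normSq (e k) / (Complex.normSq (e k) + 0))) :=
        tendsto_const_nhds.div (halim.const_add _) (by simpa using hk)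
      rw [add_zero, div_self h1] at h2
      have h3 := (Complex.continuous_ofReal.tendsto _).comp h2
      rw [Complex.ofReal_one] at h3
      exact h3.congr fun n => (hef n k).symm
    obtain ⟨y, hy, -⟩ := exists_tendsto_map_of_dominated Φ x f (fun k => (e k)⁻¹)
      (fun k => ‖e k‖⁻¹) hG (fun n => h0.mono fun k hk => by
        have h1 := hefle n k
        rw [norm_mul, mul_comm] at h1
        rwa [← one_div, le_div_iff₀ (norm_pos_iff.mpr hk)])
      (h0.mono fun k hk => by
        have h1 := (heflim k hk).const_mul (e k)⁻¹
        rw [mul_one] at h1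
        refine h1.congr fun n => ?_
        rw [inv_mul_cancel_left₀ hk])
    obtain ⟨z, hz, hz'⟩ := exists_tendsto_map_of_dominated Φ x (fun n => e * f n - 1) (fun _ => 0)
      (fun _ => 2) (integrable_const _) (fun n => Filter.Eventually.of_forall fun k => by
        refine (norm_sub_le _ _).trans ?_
        have h1 := hefle n k
        simp only [ContinuousMap.mul_apply, ContinuousMap.one_apply, norm_one]
        linarith)
      (h0.mono fun k hk => by
        have h1 := (heflim k hk).sub_const 1
        rw [sub_self] at h1
        exact h1)
    have hz0 : z = 0 := by simpa using hz'
    have h1 : Φ e y - x = z := by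
      refine tendsto_nhds_unique ((((Φ e).continuous.tendsto y).comp hy).sub_const x)
        (hz.congr fun n => ?_)
      rw [map_sub, map_mul, map_one]
      rfl
    rw [hz0, sub_eq_zero, he] at h1
    exact h1 ▸ hB.resolvent_mem hI y

/-- With y = (B + i)x, Re⟨x, Bx⟩ = Re⟨y, Φ(e)y⟩ is the integral of Re e = |e|² Re(1/e) against the
measure of y, and |e|² turns that measure into the one of x. -/
theorem inner_apply_eq_integral_re_inv (x : B.domain) :
    ⟪(x : H), B x⟫_ℂ = ((∫ k, (e k)⁻¹.re ∂functionalMeasure Φ (x : H) : ℝ) : ℂ) := by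
  have hI : (-Complex.I).im ≠ 0 := by simp
  set y := B x - (-Complex.I) • (x : H) with hy
  have hx : Φ e y = x := by
    rw [he]
    exact hB.resolvent_apply_sub_smul hI x
  have hBx : B x = y - Complex.I • (x : H) := by
    rw [hy]
    module
  have h1 : (⟪(x : H), B x⟫_ℂ).re = ∫ k, (e k).re ∂functionalMeasure Φ y := by
    have h2 : (⟪(x : H), y⟫_ℂ).re = (⟪y, (x : H)⟫_ℂ).re := by
      rw [← inner_conj_symm, Complex.conj_re]
    have h3 : (Complex.I * ⟪(x : H), (x : H)⟫_ℂ).re = 0 := by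
      rw [Complex.I_mul_re, show (⟪(x : H), (x : H)⟫_ℂ).im = 0 from inner_self_im (𝕜 := ℂ) _,
        neg_zero]
    rw [hBx, inner_sub_right, inner_smul_right, Complex.sub_re, h3, sub_zero, h2]
    conv_lhs => rw [← hx]
    rw [inner_map_eq_integral]
    exact (integral_re (integrable_continuousMap _ e)).symm
  have h4 : ∫ k, (e k)⁻¹.re ∂functionalMeasure Φ (x : H) =
      ∫ k, (e k).re ∂functionalMeasure Φ y := by
    rw [← hx, functionalMeasure_map, integral_withDensity_eq_integral_toReal_smul
      (measurable_ofReal_normSq e)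
      (Filter.Eventually.of_forall fun _ => ENNReal.ofReal_lt_top)]
    refine integral_congr_ae (Filter.Eventually.of_forall fun k => ?_)
    simp only [smul_eq_mul]
    rw [ENNReal.toReal_ofReal (Complex.normSq_nonneg _), Complex.inv_re]
    by_cases hk : e k = 0
    · simp [hk]
    · have : Complex.normSq (e k) ≠ 0 := by simpa using hk
      field_simp
  rw [h4, ← h1]
  exact Complex.ext (by simp) (by simp [im_inner_apply_self hB.symm])

theorem exists_isSpectralMeasureOf_of_map_eq_resolvent :
    ∃ E : ProjectionValuedMeasure H, E.IsSpectralMeasureOf B := by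
  have hmeas : Measurable fun k => (e k)⁻¹.re :=
    Complex.measurable_re.comp e.continuous.measurable.inv
  obtain ⟨E, hE⟩ := exists_projectionValuedMeasure
    (fun x => (functionalMeasure Φ x).map fun k => (e k)⁻¹.re)
    (fun x => by
      rw [map_measureReal_apply hmeas MeasurableSet.univ, Set.preimage_univ,
        functionalMeasure_real_univ])
    (fun S hS => by
      obtain ⟨P, hP, hP'⟩ := exists_isStarProjection_inner_eq Φ (hmeas hS)
      exact ⟨P, hP, fun x => by rw [hP', map_measureReal_apply hmeas hS]⟩)
  refine ⟨E, fun x => ?_, fun x => ?_⟩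
  · rw [hE, integrable_map_measure (by fun_prop) hmeas.aemeasurable]
    exact integrable_sq_re_inv_iff_mem_domain Φ hB e he x
  · rw [hE, integral_map hmeas.aemeasurable (by fun_prop)]
    exact inner_apply_eq_integral_re_inv Φ hB e he x

end CompactSpace

/-- The **spectral theorem** for unbounded self-adjoint operators. -/
theorem IsSymmetricWithResolvents.exists_isSpectralMeasureOf {H : Type*} [NormedAddCommGroup H]
    [InnerProductSpace ℂ H] [CompleteSpace H] {B : H →ₗ.[ℂ] H}
    (hB : IsSymmetricWithResolvents B) : ∃ E : ProjectionValuedMeasure H,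
      E.IsSpectralMeasureOf B := by
  have hI : (-Complex.I).im ≠ 0 := by simp
  have hI' : Complex.I.im ≠ 0 := by simp
  obtain ⟨R, -, hR⟩ := hB.exists_clm_eq_resolvent hI
  obtain ⟨R', -, hR'⟩ := hB.exists_clm_eq_resolvent hI'
  have hadj : star R = R' := by
    rw [ContinuousLinearMap.star_eq_adjoint]
    symm
    rw [ContinuousLinearMap.eq_adjoint_iff]
    intro x y
    rw [hR, hR', hB.inner_resolvent_conj hI', Complex.conj_I]
  have hnormal : IsStarNormal R := by
    refine ⟨?_⟩
    rw [hadj]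
    ext x
    have h1 := hB.resolvent_eq_resolvent_add hI' hI x
    have h2 := hB.resolvent_eq_resolvent_add hI hI' x
    rw [← hR, ← hR', map_add, map_smul] at h1
    rw [← hR, ← hR', map_add, map_smul] at h2
    -- Adding the resolvent identities for (i, -i) and (-i, i) leaves only the commutator.
    have h3 : (Complex.I - -Complex.I) • (R (R' x) - R' (R x)) = 0 := by
      linear_combination (norm := module) (-1 : ℂ) • h1 + (-1 : ℂ) • h2
    have h4 : Complex.I - -Complex.I ≠ 0 := by
      rw [sub_neg_eq_add, ← two_mul]
      exact mul_ne_zero two_ne_zero Complex.I_ne_zero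
    have h5 := (smul_eq_zero.mp h3).resolve_left h4
    exact (sub_eq_zero.mp h5).symm
  refine exists_isSpectralMeasureOf_of_map_eq_resolvent (cfcHom hnormal) hB
    ((ContinuousMap.id ℂ).restrict (spectrum ℂ R)) fun y => ?_
  rw [cfcHom_id hnormal, hR]

theorem IsSymmetricWithResolvents.isSpectralMeasureOf_spectralMeasure {H : Type*}
    [NormedAddCommGroup H] [InnerProductSpace ℂ H] [CompleteSpace H] {B : H →ₗ.[ℂ] H}
    (hB : IsSymmetricWithResolvents B) : (spectralMeasure B).IsSpectralMeasureOf B := by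
  have h := hB.exists_isSpectralMeasureOf
  rw [spectralMeasure, dif_pos h]
  exact h.choose_spec

/-! ### Poisson integrals of measures on the line -/

/-- `π` times the Poisson kernel of the half plane. -/
def lorentzian (x ε s : ℝ) : ℝ := ε / ((s - x) ^ 2 + ε ^ 2)

theorem lorentzian_nonneg {ε : ℝ} (hε : 0 < ε) (x s : ℝ) : 0 ≤ lorentzian x ε s := by
  unfold lorentzian
  positivity

theorem lorentzian_le {ε : ℝ} (hε : 0 < ε) (x s : ℝ) : lorentzian x ε s ≤ ε⁻¹ := by
  unfold lorentzian
  rw [inv_eq_one_div, div_le_div_iff₀ (by positivity) hε]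
  nlinarith [sq_nonneg (s - x)]

theorem continuous_lorentzian {ε : ℝ} (hε : 0 < ε) :
    Continuous fun p : ℝ × ℝ => lorentzian p.1 ε p.2 := by
  unfold lorentzian
  refine continuous_const.div (by fun_prop) fun p => ?_
  positivity

theorem measurable_lorentzian {ε : ℝ} (hε : 0 < ε) (x : ℝ) :
    Measurable fun s => ENNReal.ofReal (lorentzian x ε s) :=
  ((continuous_lorentzian hε).comp (Continuous.prodMk_right x)).measurable.ennreal_ofReal

theorem measure_Ioo_le_lintegral_lorentzian (ν : Measure ℝ) (x : ℝ) {ε : ℝ} (hε : 0 < ε) :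
    ν (Set.Ioo (x - ε) (x + ε)) ≤
      ENNReal.ofReal (2 * ε) * ∫⁻ s, ENNReal.ofReal (lorentzian x ε s) ∂ν := by
  rw [← lintegral_const_mul _ (measurable_lorentzian hε x),
    ← lintegral_indicator_one measurableSet_Ioo]
  refine lintegral_mono fun s => ?_
  by_cases hs : s ∈ Set.Ioo (x - ε) (x + ε)
  · rw [Set.indicator_of_mem hs, Pi.one_apply, ← ENNReal.ofReal_mul (by positivity),
      ENNReal.one_le_ofReal, lorentzian, mul_div_assoc', le_div_iff₀ (by positivity)]
    nlinarith [hs.1, hs.2]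
  · rw [Set.indicator_of_notMem hs]
    exact zero_le

theorem lintegral_Ioi_of_hasDerivAt_of_nonneg {g g' : ℝ → ℝ} {a l : ℝ}
    (hderiv : ∀ x ∈ Set.Ici a, HasDerivAt g (g' x) x) (g'pos : ∀ x ∈ Set.Ioi a, 0 ≤ g' x)
    (hg : Filter.Tendsto g Filter.atTop (nhds l)) :
    ∫⁻ x in Set.Ioi a, ENNReal.ofReal (g' x) = ENNReal.ofReal (l - g a) := by
  rw [← integral_Ioi_of_hasDerivAt_of_nonneg' hderiv g'pos hg,
    ofReal_integral_eq_lintegral_ofReal (integrableOn_Ioi_deriv_of_nonneg' hderiv g'pos hg)]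
  exact (ae_restrict_mem measurableSet_Ioi).mono g'pos

theorem lintegral_Ioi_lorentzian (b s : ℝ) {ε : ℝ} (hε : 0 < ε) :
    ∫⁻ x in Set.Ioi b, ENNReal.ofReal (lorentzian x ε s) =
      ENNReal.ofReal (Real.pi / 2 - Real.arctan ((b - s) / ε)) := by
  refine lintegral_Ioi_of_hasDerivAt_of_nonneg (g := fun x => Real.arctan ((x - s) / ε))
    (fun x _ => ?_) (fun x _ => lorentzian_nonneg hε x s) ?_
  · have h := (((hasDerivAt_id x).sub_const s).div_const ε).arctan
    convert! h using 1
    unfold lorentzian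
    have h1 : (s - x) ^ 2 + ε ^ 2 ≠ 0 := by positivity
    have h2 : 1 + ((x - s) / ε) ^ 2 ≠ 0 := by positivity
    simp only [id]
    field_simp
    ring
  · refine (Real.tendsto_arctan_atTop.mono_right nhdsWithin_le_nhds).comp ?_
    exact (Filter.tendsto_atTop_add_const_right _ (-s) Filter.tendsto_id).atTop_div_const hε

section Measurability

variable {X : Type*} [MeasurableSpace X]

theorem integrable_lorentzian (ν : Measure ℝ) [IsFiniteMeasure ν] (x : ℝ) {ε : ℝ} (hε : 0 < ε) :
    Integrable (lorentzian x ε) ν :=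
  Integrable.of_bound (C := ε⁻¹)
    ((continuous_lorentzian hε).comp (Continuous.prodMk_right x)).aestronglyMeasurable
    (Filter.Eventually.of_forall fun s => by
      rw [Real.norm_eq_abs, abs_of_nonneg (lorentzian_nonneg hε x s)]
      exact lorentzian_le hε x s)

/-- Integrating the kernel over its centre x ∈ (b, ∞) gives the arctangent, so Tonelli reduces the
claim to joint measurability in (x, a). The Poisson integral is continuous in x and measurable in a,
which suffices. -/
theorem measurable_lintegral_Ioi_lintegral_lorentzian (κ : X → Measure ℝ)
    [∀ a, IsProbabilityMeasure (κ a)] {ε : ℝ} (hε : 0 < ε)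
    (h : ∀ x, Measurable fun a => ∫⁻ s, ENNReal.ofReal (lorentzian x ε s) ∂κ a) (b : ℝ) :
    Measurable fun a => ∫⁻ s, ENNReal.ofReal (Real.pi / 2 - Real.arctan ((b - s) / ε)) ∂κ a := by
  have h1 : ∀ a, ∫⁻ s, ENNReal.ofReal (Real.pi / 2 - Real.arctan ((b - s) / ε)) ∂κ a =
      ∫⁻ x in Set.Ioi b, ENNReal.ofReal (∫ s, lorentzian x ε s ∂κ a) := by
    intro a
    simp_rw [← lintegral_Ioi_lorentzian b _ hε]
    rw [lintegral_lintegral_swap]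
    · refine lintegral_congr fun x => ?_
      rw [ofReal_integral_eq_lintegral_ofReal (integrable_lorentzian _ x hε)
        (Filter.Eventually.of_forall fun s => lorentzian_nonneg hε x s)]
    · exact (((continuous_lorentzian hε).comp continuous_swap).measurable.ennreal_ofReal).aemeasurable
  simp_rw [h1]
  have h2 : Measurable (Function.uncurry fun (x : ℝ) (a : X) => ∫ s, lorentzian x ε s ∂κ a) := by
    refine measurable_uncurry_of_continuous_of_measurable (fun a => ?_) fun x => ?_
    · refine continuous_of_dominated (bound := fun _ => ε⁻¹)
        (fun x => (integrable_lorentzian _ x hε).aestronglyMeasurable)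
        (fun x => Filter.Eventually.of_forall fun s => ?_) (integrable_const _)
        (Filter.Eventually.of_forall fun s =>
          (continuous_lorentzian hε).comp (Continuous.prodMk_left s))
      rw [Real.norm_eq_abs, abs_of_nonneg (lorentzian_nonneg hε x s)]
      exact lorentzian_le hε x s
    · have h3 : (fun a => ∫ s, lorentzian x ε s ∂κ a) =
          fun a => (∫⁻ s, ENNReal.ofReal (lorentzian x ε s) ∂κ a).toReal := funext fun a =>
        integral_eq_lintegral_of_nonneg_ae
          (Filter.Eventually.of_forall fun s => lorentzian_nonneg hε x s)
          (integrable_lorentzian _ x hε).aestronglyMeasurable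
      rw [h3]
      exact (h x).ennreal_toReal
  exact (h2.ennreal_ofReal.comp measurable_swap).lintegral_prod_right'

/-- A family of probability measures is measurable if its Poisson integrals are. -/
theorem measurable_of_measurable_lintegral_lorentzian (κ : X → Measure ℝ)
    [∀ a, IsProbabilityMeasure (κ a)]
    (h : ∀ x ε, 0 < ε → Measurable fun a => ∫⁻ s, ENNReal.ofReal (lorentzian x ε s) ∂κ a) :
    Measurable κ := by
  refine Measurable.measure_of_isPiSystem_of_isProbabilityMeasure
    ((BorelSpace.measurable_eq (α := ℝ)).trans (borel_eq_generateFrom_Ioi ℝ)) isPiSystem_Ioi ?_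
  rintro _ ⟨b, rfl⟩
  let δ : ℕ → ℝ := fun n => 1 / ((n : ℝ) + 1)
  have hδ : ∀ n, 0 < δ n := fun n => by positivity
  have hδlim : Filter.Tendsto δ Filter.atTop (nhds 0) := tendsto_one_div_add_atTop_nhds_zero_nat
  have hδlim' : Filter.Tendsto (fun n => (δ n)⁻¹) Filter.atTop Filter.atTop :=
    (tendsto_nhdsWithin_iff.mpr ⟨hδlim, Filter.Eventually.of_forall hδ⟩ :
      Filter.Tendsto δ Filter.atTop (nhdsWithin 0 (Set.Ioi 0))).inv_tendsto_nhdsGT_zero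
  -- The width δ² is much smaller than the shift δ, so that at the endpoint s = b the argument is
  -- 1/δ and the limit is 0, not π/2.
  let k : ℕ → ℝ → ℝ := fun n s => Real.pi / 2 - Real.arctan ((b + δ n - s) / δ n ^ 2)
  have hk : ∀ s, Filter.Tendsto (fun n => k n s) Filter.atTop
      (nhds ((Set.Ioi b).indicator (fun _ => Real.pi) s)) := by
    intro s
    by_cases hs : b < s
    · have h1 : Filter.Tendsto (fun n => (b + δ n - s) / δ n ^ 2) Filter.atTop Filter.atBot := by
        have h2 : Filter.Tendsto (fun n => b + δ n - s) Filter.atTop (nhds (b + 0 - s)) :=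
          (hδlim.const_add b).sub_const s
        have h3 : Filter.Tendsto (fun n => (δ n)⁻¹ * (δ n)⁻¹) Filter.atTop Filter.atTop :=
          hδlim'.atTop_mul_atTop₀ hδlim'
        refine (h2.neg_mul_atTop (by linarith) h3).congr fun n => ?_
        rw [div_eq_mul_inv, sq, mul_inv]
      have h4 := (Real.tendsto_arctan_atBot.mono_right nhdsWithin_le_nhds).comp h1
      have h5 := h4.const_sub (Real.pi / 2)
      rw [Set.indicator_of_mem (Set.mem_Ioi.mpr hs)]
      convert! h5 using 2
      ring
    · have h1 : Filter.Tendsto (fun n => (b + δ n - s) / δ n ^ 2) Filter.atTop Filter.atTop := by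
        refine Filter.tendsto_atTop_mono (fun n => ?_) hδlim'
        rw [inv_eq_one_div, div_le_div_iff₀ (hδ n) (pow_pos (hδ n) 2)]
        push Not at hs
        nlinarith [mul_nonneg (hδ n).le (sub_nonneg.mpr hs)]
      have h4 := (Real.tendsto_arctan_atTop.mono_right nhdsWithin_le_nhds).comp h1
      have h5 := h4.const_sub (Real.pi / 2)
      rw [sub_self] at h5
      rw [Set.indicator_of_notMem (show s ∉ Set.Ioi b from hs)]
      exact h5
  have hlim : ∀ a, Filter.Tendsto (fun n => ∫⁻ s, ENNReal.ofReal (k n s) ∂κ a) Filter.atTop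
      (nhds (ENNReal.ofReal Real.pi * κ a (Set.Ioi b))) := by
    intro a
    rw [← lintegral_indicator_const measurableSet_Ioi]
    refine tendsto_lintegral_of_dominated_convergence (fun _ => ENNReal.ofReal Real.pi)
      (fun n => by fun_prop) (fun n => Filter.Eventually.of_forall fun s => ?_) ?_
      (Filter.Eventually.of_forall fun s => ?_)
    · refine ENNReal.ofReal_le_ofReal ?_
      have := Real.neg_pi_div_two_lt_arctan ((b + δ n - s) / δ n ^ 2)
      simp only [k]
      linarith
    · rw [lintegral_const, measure_univ, mul_one]
      exact ENNReal.ofReal_ne_top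
    · have h1 := (ENNReal.continuous_ofReal.tendsto _).comp (hk s)
      convert! h1 using 2
      by_cases hs : s ∈ Set.Ioi b <;> simp [hs]
  have hm : Measurable fun a => ENNReal.ofReal Real.pi * κ a (Set.Ioi b) := by
    refine measurable_of_tendsto_metrizable (fun n => ?_) (tendsto_pi_nhds.mpr hlim)
    exact measurable_lintegral_Ioi_lintegral_lorentzian κ (pow_pos (hδ n) 2)
      (fun x => h x _ (pow_pos (hδ n) 2)) (b + δ n)
  have h1 := hm.const_mul (ENNReal.ofReal Real.pi)⁻¹
  simp only [← mul_assoc, ENNReal.inv_mul_cancel (by simpa using Real.pi_pos :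
    ENNReal.ofReal Real.pi ≠ 0) ENNReal.ofReal_ne_top, one_mul] at h1
  exact h1

end Measurability

/-! ### Poisson integrals of Hölder continuous measures -/

/-- Layer-cake form of the kernel: a superposition over r of the indicators of |t - u| < r, at y =
|t - u|. -/
theorem lintegral_Ioi_layer (y : ℝ) (hy : 0 ≤ y) {v : ℝ} (hv : 0 < v) :
    ∫⁻ r in Set.Ioi y, ENNReal.ofReal (2 * r * v / (r ^ 2 + v ^ 2) ^ 2) =
      ENNReal.ofReal (v / (y ^ 2 + v ^ 2)) := by
  have h := lintegral_Ioi_of_hasDerivAt_of_nonneg (g := fun r => -v / (r ^ 2 + v ^ 2))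
    (g' := fun r => 2 * r * v / (r ^ 2 + v ^ 2) ^ 2) (a := y) (l := 0) (fun r _ => ?_)
    (fun r hr => ?_) ?_
  · rw [h]
    congr 1
    ring
  · have h1 : r ^ 2 + v ^ 2 ≠ 0 := by positivity
    have h2 := (hasDerivAt_const r (-v)).div ((hasDerivAt_pow 2 r).add_const (v ^ 2)) h1
    convert! h2 using 1
    simp
    ring
  · have : 0 < r := hy.trans_lt hr
    positivity
  · refine Filter.Tendsto.const_div_atTop ?_ _
    exact Filter.tendsto_atTop_add_const_right _ _ (Filter.tendsto_pow_atTop two_ne_zero)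

theorem lintegral_Ioi_layer_mul {v : ℝ} (hv : 0 < v) :
    ∫⁻ r in Set.Ioi 0, ENNReal.ofReal (2 * r * v / (r ^ 2 + v ^ 2) ^ 2 * (1 + r / v)) =
      ENNReal.ofReal ((1 + Real.pi / 2) / v) := by
  have hsq : Filter.Tendsto (fun r : ℝ => r ^ 2 + v ^ 2) Filter.atTop Filter.atTop :=
    Filter.tendsto_atTop_add_const_right _ _ (Filter.tendsto_pow_atTop two_ne_zero)
  have h := lintegral_Ioi_of_hasDerivAt_of_nonneg
    (g := fun r => -v / (r ^ 2 + v ^ 2) + (Real.arctan (r / v) / v - r / (r ^ 2 + v ^ 2)))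
    (g' := fun r => 2 * r * v / (r ^ 2 + v ^ 2) ^ 2 * (1 + r / v)) (a := 0)
    (l := 0 + (Real.pi / 2 / v - 0)) (fun r _ => ?_) (fun r hr => ?_) ?_
  · rw [h]
    congr 1
    simp
    field_simp
    ring
  · have h1 : r ^ 2 + v ^ 2 ≠ 0 := by positivity
    have h2 := (hasDerivAt_const r (-v)).div ((hasDerivAt_pow 2 r).add_const (v ^ 2)) h1
    have h3 := (((hasDerivAt_id r).div_const v).arctan.div_const v).sub
      ((hasDerivAt_id r).div ((hasDerivAt_pow 2 r).add_const (v ^ 2)) h1)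
    convert! h2.add h3 using 1
    have h4 : 1 + (r / v) ^ 2 = (r ^ 2 + v ^ 2) / v ^ 2 := by
      field_simp
      ring
    simp only [id, h4]
    field_simp
    ring
  · have : 0 < r := hr
    positivity
  · refine (hsq.const_div_atTop _).add (Filter.Tendsto.sub ?_ ?_)
    · refine Filter.Tendsto.div_const ?_ v
      exact (Real.tendsto_arctan_atTop.mono_right nhdsWithin_le_nhds).comp
        (Filter.tendsto_id.atTop_div_const hv)
    · refine squeeze_zero' (g := fun r : ℝ => r⁻¹) ?_ ?_ tendsto_inv_atTop_zero
      · filter_upwards [Filter.eventually_gt_atTop 0] with r hr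
        positivity
      · filter_upwards [Filter.eventually_gt_atTop 0] with r hr
        rw [inv_eq_one_div, div_le_div_iff₀ (by positivity) hr]
        nlinarith [sq_nonneg v]

/-- With a = r/v this makes the layer-cake integral elementary, with the constant 1 + π/2 for all α.
-/
theorem rpow_le_one_add {a α : ℝ} (ha : 0 ≤ a) (hα0 : 0 ≤ α) (hα1 : α ≤ 1) :
    a ^ α ≤ 1 + a := by
  rcases le_total a 1 with h | h
  · exact (Real.rpow_le_one ha h hα0).trans (by linarith)
  · have := Real.rpow_le_rpow_of_exponent_le h hα1
    rw [Real.rpow_one] at this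
    linarith

/-- After Tonelli only the masses of the intervals (u - r, u + r) occur. They are bounded by d
(2v)^α (1 + r/v), and `lintegral_Ioi_layer_mul` evaluates the rest. -/
theorem lintegral_lorentzian_le {μ : Measure ℝ} [SFinite μ] {α : ℝ} (hα0 : 0 ≤ α) (hα1 : α ≤ 1)
    {d : ℝ≥0∞} (u : ℝ)
    (hμ : ∀ r > 0, μ (Set.Ioo (u - r) (u + r)) ≤ d * ENNReal.ofReal ((2 * r) ^ α))
    {v : ℝ} (hv : 0 < v) :
    ∫⁻ t, ENNReal.ofReal (lorentzian u v t) ∂μ ≤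
      d * ENNReal.ofReal ((2 * v) ^ α / v * (1 + Real.pi / 2)) := by
  let k : ℝ → ℝ≥0∞ := fun r => ENNReal.ofReal (2 * r * v / (r ^ 2 + v ^ 2) ^ 2)
  have hk : Measurable k := by
    have : Continuous fun r : ℝ => 2 * r * v / (r ^ 2 + v ^ 2) ^ 2 :=
      (by fun_prop : Continuous fun r : ℝ => 2 * r * v).div (by fun_prop) fun r => by positivity
    exact this.measurable.ennreal_ofReal
  have hset : MeasurableSet {p : ℝ × ℝ | |p.1 - u| < p.2} :=
    measurableSet_lt (by fun_prop) measurable_snd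
  have h1 : ∀ t, ENNReal.ofReal (lorentzian u v t) =
      ∫⁻ r, {p : ℝ × ℝ | |p.1 - u| < p.2}.indicator (fun p => k p.2) (t, r) := by
    intro t
    have h2 := lintegral_Ioi_layer |t - u| (abs_nonneg _) hv
    rw [sq_abs] at h2
    rw [lorentzian, ← h2, ← lintegral_indicator measurableSet_Ioi]
    rfl
  simp_rw [h1]
  rw [lintegral_lintegral_swap
    (f := fun t r => {p : ℝ × ℝ | |p.1 - u| < p.2}.indicator (fun p => k p.2) (t, r)) ((hk.comp measurable_snd).indicator hset).aemeasurable]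
  have h3 : ∀ r, ∫⁻ t, {p : ℝ × ℝ | |p.1 - u| < p.2}.indicator (fun p => k p.2) (t, r) ∂μ ≤
      (Set.Ioi 0).indicator (fun r => d * ENNReal.ofReal ((2 * v) ^ α) *
        ENNReal.ofReal (2 * r * v / (r ^ 2 + v ^ 2) ^ 2 * (1 + r / v))) r := by
    intro r
    have h4 : ∀ t, {p : ℝ × ℝ | |p.1 - u| < p.2}.indicator (fun p => k p.2) (t, r) =
        (Set.Ioo (u - r) (u + r)).indicator (fun _ => k r) t := by
      intro t
      have h5 : |t - u| < r ↔ t ∈ Set.Ioo (u - r) (u + r) := by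
        rw [abs_lt, Set.mem_Ioo]
        constructor <;> rintro ⟨h, h'⟩ <;> constructor <;> linarith
      by_cases h : t ∈ Set.Ioo (u - r) (u + r)
      · rw [Set.indicator_of_mem h, Set.indicator_of_mem
          (show (t, r) ∈ {p : ℝ × ℝ | |p.1 - u| < p.2} from h5.mpr h)]
      · rw [Set.indicator_of_notMem h, Set.indicator_of_notMem
          (show (t, r) ∉ {p : ℝ × ℝ | |p.1 - u| < p.2} from fun h' => h (h5.mp h'))]
    simp_rw [h4]
    rw [lintegral_indicator_const measurableSet_Ioo]
    by_cases hr : 0 < r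
    · rw [Set.indicator_of_mem (Set.mem_Ioi.mpr hr)]
      have h6 : (2 * r) ^ α ≤ (2 * v) ^ α * (1 + r / v) := by
        have h7 : 2 * r = 2 * v * (r / v) := by field_simp
        rw [h7, Real.mul_rpow (by positivity) (by positivity)]
        exact mul_le_mul_of_nonneg_left (rpow_le_one_add (by positivity) hα0 hα1) (by positivity)
      calc k r * μ (Set.Ioo (u - r) (u + r))
          ≤ k r * (d * ENNReal.ofReal ((2 * v) ^ α * (1 + r / v))) := by
            gcongr
            refine (hμ r hr).trans ?_
            gcongr
        _ = _ := by
            simp only [k]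
            rw [ENNReal.ofReal_mul (by positivity), ENNReal.ofReal_mul (by positivity)]
            ring
    · rw [Set.Ioo_eq_empty (by linarith), measure_empty, mul_zero]
      exact zero_le
  refine (lintegral_mono h3).trans ?_
  rw [lintegral_indicator measurableSet_Ioi, lintegral_const_mul _ (by fun_prop),
    lintegral_Ioi_layer_mul hv, mul_assoc, ← ENNReal.ofReal_mul (by positivity)]
  refine le_of_eq ?_
  congr 2
  ring

/-! ### Weak measurability of resolvents -/

section WeakMeasurability

variable {H : Type*} [NormedAddCommGroup H] [InnerProductSpace ℂ H] [CompleteSpace H]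
variable {Ω : Type*} [MeasurableSpace Ω]

omit [CompleteSpace H] in
theorem countable_of_orthonormal [TopologicalSpace.SeparableSpace H] {w : Set H}
    (hw : Orthonormal ℂ ((↑) : w → H)) : w.Countable := by
  refine Set.PairwiseDisjoint.countable_of_isOpen (s := fun x : H => Metric.ball x (1 / 2))
    (fun x hx y hy hxy => ?_) (fun x _ => Metric.isOpen_ball) fun x _ =>
      ⟨x, Metric.mem_ball_self (by norm_num)⟩
  refine Metric.ball_disjoint_ball ?_
  have h1 : ⟪x, y⟫_ℂ = 0 := hw.2 (i := ⟨x, hx⟩) (j := ⟨y, hy⟩) fun h => hxy (congrArg Subtype.val h)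
  have h2 : ‖x‖ = 1 := hw.1 ⟨x, hx⟩
  have h3 : ‖y‖ = 1 := hw.1 ⟨y, hy⟩
  have h4 : ‖x - y‖ ^ 2 = 2 := by
    rw [@norm_sub_sq ℂ, h1, h2, h3]
    norm_num
  rw [dist_eq_norm]
  nlinarith [norm_nonneg (x - y)]

/-- Expanding u in a Hilbert basis writes the function as a sum of products of measurable functions.
Separability makes the basis countable. -/
theorem measurable_inner_clm_apply [TopologicalSpace.SeparableSpace H] {T : Ω → H →L[ℂ] H}
    (hT : ∀ f g, Measurable fun ω => ⟪f, T ω g⟫_ℂ) {u : Ω → H}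
    (hu : ∀ f, Measurable fun ω => ⟪f, u ω⟫_ℂ) (f : H) :
    Measurable fun ω => ⟪f, T ω (u ω)⟫_ℂ := by
  obtain ⟨w, b, hb⟩ := exists_hilbertBasis ℂ H
  have hw : w.Countable := countable_of_orthonormal (hb ▸ b.orthonormal)
  have := hw.to_subtype
  have hsum : ∀ ω, HasSum (fun i => ⟪b i, u ω⟫_ℂ * ⟪f, T ω (b i)⟫_ℂ) ⟪f, T ω (u ω)⟫_ℂ := by
    intro ω
    have h := ((b.hasSum_repr (u ω)).mapL (T ω)).mapL (innerSL ℂ f)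
    simpa only [map_smul, innerSL_apply_apply, smul_eq_mul, b.repr_apply_apply] using h
  refine measurable_of_tendsto_metrizable' Filter.atTop
    (f := fun (s : Finset w) ω => ∑ i ∈ s, ⟪b i, u ω⟫_ℂ * ⟪f, T ω (b i)⟫_ℂ) (fun s => ?_)
    (tendsto_pi_nhds.mpr hsum)
  exact Finset.measurable_fun_sum s fun i _ => (hu _).mul (hT _ _)

/-- Neumann iteration: v ↦ (A - w)⁻¹(g + (z - w)v) is a contraction with ratio |z - w| / |Im w| and
fixed point (A - z)⁻¹g, and each iterate is weakly measurable. -/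
theorem measurable_inner_resolvent_of_dist_lt [TopologicalSpace.SeparableSpace H]
    {A : Ω → H →ₗ.[ℂ] H} (hA : ∀ ω, IsSymmetricWithResolvents (A ω)) {z w : ℂ} (hz : z.im ≠ 0)
    (hw : w.im ≠ 0) (hzw : ‖z - w‖ < |w.im|)
    (h : ∀ f g, Measurable fun ω => ⟪f, resolvent (A ω) w g⟫_ℂ) (f g : H) :
    Measurable fun ω => ⟪f, resolvent (A ω) z g⟫_ℂ := by
  choose R hR hRA using fun ω => (hA ω).exists_clm_eq_resolvent hw
  have hRm : ∀ f g, Measurable fun ω => ⟪f, R ω g⟫_ℂ := by simpa only [hRA] using h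
  let u : ℕ → Ω → H := fun n => Nat.rec (fun _ => 0) (fun _ v ω => R ω (g + (z - w) • v ω)) n
  have hu : ∀ n f, Measurable fun ω => ⟪f, u n ω⟫_ℂ := by
    intro n
    induction n with
    | zero => intro f; simp [u]
    | succ n ih =>
      refine measurable_inner_clm_apply hRm fun f => ?_
      simp only [inner_add_right, inner_smul_right]
      exact ((ih f).const_mul _).const_add _
  have hpos : 0 < |w.im| := abs_pos.mpr hw
  have hnorm : ∀ n ω, ‖u n ω - resolvent (A ω) z g‖ ≤
      (|w.im|⁻¹ * ‖z - w‖) ^ n * ‖resolvent (A ω) z g‖ := by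
    intro n ω
    induction n with
    | zero => simp [u]
    | succ n ih =>
      have h1 : u (n + 1) ω - resolvent (A ω) z g =
          R ω ((z - w) • (u n ω - resolvent (A ω) z g)) := by
        conv_lhs => rw [(hA ω).resolvent_eq_resolvent_add hz hw, ← hRA]
        change R ω (g + (z - w) • u n ω) - _ = _
        rw [← map_sub]
        congr 1
        module
      rw [h1]
      calc ‖R ω ((z - w) • (u n ω - resolvent (A ω) z g))‖
          ≤ |w.im|⁻¹ * ‖(z - w) • (u n ω - resolvent (A ω) z g)‖ := (R ω).le_of_opNorm_le (hR ω) _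
        _ = |w.im|⁻¹ * ‖z - w‖ * ‖u n ω - resolvent (A ω) z g‖ := by rw [norm_smul, mul_assoc]
        _ ≤ |w.im|⁻¹ * ‖z - w‖ * ((|w.im|⁻¹ * ‖z - w‖) ^ n * ‖resolvent (A ω) z g‖) := by gcongr
        _ = _ := by ring
  refine measurable_of_tendsto_metrizable (hu · f) (tendsto_pi_nhds.mpr fun ω => ?_)
  refine tendsto_const_nhds.inner (tendsto_iff_norm_sub_tendsto_zero.mpr ?_)
  refine squeeze_zero (fun n => norm_nonneg _) (fun n => hnorm n ω) ?_
  have hlt : |w.im|⁻¹ * ‖z - w‖ < 1 := by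
    rwa [inv_mul_eq_div, div_lt_one hpos]
  have h2 := (tendsto_pow_atTop_nhds_zero_of_lt_one (by positivity) hlt).mul_const
    ‖resolvent (A ω) z g‖
  rwa [zero_mul] at h2

theorem measurable_inner_resolvent [TopologicalSpace.SeparableSpace H]
    {A : Ω → H →ₗ.[ℂ] H} (hA : IsSelfAdjointRandomOperator A) {z : ℂ} (hz : z.im < 0) (f g : H) :
    Measurable fun ω => ⟪f, resolvent (A ω) z g⟫_ℂ := by
  have hA' := fun ω => isSymmetricWithResolvents_of_isSelfAdjoint (hA.1 ω)
  -- Starting at -i, each centre lies in the disc of radius |Im w| about the preceding one. These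
  -- discs touch the real axis at 0 and exhaust the lower half plane.
  let w : ℕ → ℂ := fun n => ⟨0, -(3 / 2) ^ n⟩
  have hpow : ∀ n : ℕ, (0 : ℝ) < (3 / 2) ^ n := fun n => by positivity
  have hwim : ∀ n, (w n).im ≠ 0 := fun n => (neg_neg_of_pos (hpow n)).ne
  have hwabs : ∀ n, |(w n).im| = (3 / 2) ^ n := fun n => by
    rw [show (w n).im = -(3 / 2) ^ n from rfl, abs_neg, abs_of_pos (hpow n)]
  have hwm : ∀ n f g, Measurable fun ω => ⟪f, resolvent (A ω) (w n) g⟫_ℂ := by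
    intro n
    induction n with
    | zero =>
      have : w 0 = -Complex.I := Complex.ext (by simp [w]) (by simp [w])
      rw [this]
      exact hA.2
    | succ n ih =>
      refine measurable_inner_resolvent_of_dist_lt hA' (hwim (n + 1)) (hwim n) ?_ ih
      have h1 : w (n + 1) - w n = (((3 / 2) ^ n / 2 : ℝ) : ℂ) * -Complex.I := by
        refine Complex.ext (by rw [Complex.re_ofReal_mul]; simp [w]) ?_
        rw [Complex.im_ofReal_mul, Complex.sub_im]
        simp only [w, Complex.neg_im, Complex.I_im]
        ring
      rw [h1, hwabs, norm_mul, norm_neg, Complex.norm_I, mul_one, Complex.norm_real,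
        Real.norm_eq_abs, abs_of_pos (by positivity)]
      linarith [hpow n]
  obtain ⟨n, hn⟩ := pow_unbounded_of_one_lt ((z.re ^ 2 + z.im ^ 2) / (-2 * z.im))
    (by norm_num : (1 : ℝ) < 3 / 2)
  refine measurable_inner_resolvent_of_dist_lt hA' hz.ne (hwim n) ?_ (hwm n) f g
  rw [div_lt_iff₀ (by linarith)] at hn
  rw [hwabs]
  refine lt_of_pow_lt_pow_left₀ 2 (hpow n).le ?_
  rw [← Complex.normSq_eq_norm_sq, Complex.normSq_apply]
  simp only [Complex.sub_re, Complex.sub_im, w]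
  nlinarith

end WeakMeasurability

/-! ### Poisson integrals of the perturbed and averaged spectral measures -/

section Averaging

variable {H : Type*} [NormedAddCommGroup H] [InnerProductSpace ℂ H] [CompleteSpace H]
variable {A : H →ₗ.[ℂ] H} {φ : H}

/-- The Poisson integral of the spectral measure of `A + t P_φ` at `φ`, in terms of
the value `F` of the Borel transform of the spectral measure of `A` at `φ`. -/
def aronszajnKrein (F : ℂ) (t : ℝ) : ℝ := -F.im / Complex.normSq (1 + t * F)

theorem measurable_aronszajnKrein : Measurable fun p : ℂ × ℝ => aronszajnKrein p.1 p.2 := by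
  unfold aronszajnKrein
  refine (Complex.measurable_im.comp measurable_fst).neg.div
    (Complex.continuous_normSq.measurable.comp ?_)
  fun_prop

theorem lintegral_lorentzian_perturbedSpectralMeasure (hA : IsSymmetricWithResolvents A)
    (hφ : ‖φ‖ = 1) (t x : ℝ) {ε : ℝ} (hε : 0 < ε) :
    ∫⁻ s, ENNReal.ofReal (lorentzian x ε s) ∂perturbedSpectralMeasure A φ t =
      ENNReal.ofReal (aronszajnKrein ⟪φ, resolvent A ⟨x, -ε⟩ φ⟫_ℂ t) := by
  set z : ℂ := ⟨x, -ε⟩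
  have hz : z.im ≠ 0 := (neg_neg_of_pos hε).ne
  have hAt := hA.rankOnePerturbation hφ t
  have h1 := hAt.isSpectralMeasureOf_spectralMeasure.lintegral_inv_normSq_sub hAt hz φ
  rw [norm_sq_resolvent_rankOnePerturbation hA hφ t hz] at h1
  have h2 : ∀ s : ℝ, ENNReal.ofReal (lorentzian x ε s) =
      ENNReal.ofReal ε * ENNReal.ofReal (Complex.normSq (s - z))⁻¹ := by
    intro s
    rw [← ENNReal.ofReal_mul hε.le, lorentzian, Complex.normSq_apply, div_eq_mul_inv]
    simp only [Complex.sub_re, Complex.ofReal_re, Complex.sub_im, Complex.ofReal_im, z]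
    congr 3
    ring
  simp_rw [h2]
  rw [lintegral_const_mul' _ _ ENNReal.ofReal_ne_top, perturbedSpectralMeasure, h1,
    ← ENNReal.ofReal_mul hε.le, aronszajnKrein]
  congr 1
  rw [show z.im = -ε from rfl]
  field_simp

theorem isProbabilityMeasure_perturbedSpectralMeasure (A : H →ₗ.[ℂ] H) (hφ : ‖φ‖ = 1) (t : ℝ) :
    IsProbabilityMeasure (perturbedSpectralMeasure A φ t) :=
  ⟨by rw [perturbedSpectralMeasure, ProjectionValuedMeasure.scalarMeasure_univ, hφ]; simp⟩

theorem measurable_perturbedSpectralMeasure (hA : IsSymmetricWithResolvents A) (hφ : ‖φ‖ = 1) :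
    Measurable (perturbedSpectralMeasure A φ) := by
  have := isProbabilityMeasure_perturbedSpectralMeasure A hφ
  refine measurable_of_measurable_lintegral_lorentzian _ fun x ε hε => ?_
  simp_rw [lintegral_lorentzian_perturbedSpectralMeasure hA hφ _ x hε]
  exact (measurable_aronszajnKrein.comp measurable_prodMk_left).ennreal_ofReal

theorem lintegral_lorentzian_averagedSpectralMeasure (μ : Measure ℝ)
    (hA : IsSymmetricWithResolvents A) (hφ : ‖φ‖ = 1) (x : ℝ) {ε : ℝ} (hε : 0 < ε) :
    ∫⁻ s, ENNReal.ofReal (lorentzian x ε s) ∂averagedSpectralMeasure μ A φ =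
      ∫⁻ t, ENNReal.ofReal (aronszajnKrein ⟪φ, resolvent A ⟨x, -ε⟩ φ⟫_ℂ t) ∂μ := by
  rw [averagedSpectralMeasure, Measure.lintegral_bind
    (measurable_perturbedSpectralMeasure hA hφ).aemeasurable
    (measurable_lorentzian hε x).aemeasurable]
  simp_rw [lintegral_lorentzian_perturbedSpectralMeasure hA hφ _ x hε]

theorem isProbabilityMeasure_averagedSpectralMeasure (μ : Measure ℝ) [IsProbabilityMeasure μ]
    (hA : IsSymmetricWithResolvents A) (hφ : ‖φ‖ = 1) :
    IsProbabilityMeasure (averagedSpectralMeasure μ A φ) := by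
  have := isProbabilityMeasure_perturbedSpectralMeasure A hφ
  exact isProbabilityMeasure_bind (measurable_perturbedSpectralMeasure hA hφ).aemeasurable
    (Filter.Eventually.of_forall this)

/-- Completing the square: |1 + tF|² = |F|² |t + 1/F|². This exchanges the spectral variable for the
coupling constant. -/
theorem aronszajnKrein_eq_lorentzian {F : ℂ} (hF : F.im < 0) (t : ℝ) :
    aronszajnKrein F t = lorentzian (-F.re / Complex.normSq F) (-F.im / Complex.normSq F) t := by
  have h0 : F ≠ 0 := fun h => by simp [h] at hF
  have h1 : 0 < Complex.normSq F := Complex.normSq_pos.mpr h0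
  have h2 : Complex.normSq (1 + t * F) = Complex.normSq F *
      ((t - -F.re / Complex.normSq F) ^ 2 + (-F.im / Complex.normSq F) ^ 2) := by
    have h3 : Complex.normSq F *
        ((t - -F.re / Complex.normSq F) ^ 2 + (-F.im / Complex.normSq F) ^ 2) =
        t ^ 2 * Complex.normSq F + 2 * t * F.re + (F.re ^ 2 + F.im ^ 2) / Complex.normSq F := by
      field_simp
      ring
    have h4 : F.re ^ 2 + F.im ^ 2 = Complex.normSq F := by rw [Complex.normSq_apply]; ring
    rw [h3, h4, div_self h1.ne', ← h4, Complex.normSq_apply]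
    simp
    ring
  rw [aronszajnKrein, h2, lorentzian, div_div]

theorem lintegral_lorentzian_averagedSpectralMeasure_le {μ : Measure ℝ} [SFinite μ]
    (hA : IsSymmetricWithResolvents A) (hφ : ‖φ‖ = 1) {α : ℝ} (hα0 : 0 ≤ α) (hα1 : α ≤ 1)
    {d : ℝ≥0∞}
    (hμ : ∀ u, ∀ r > 0, μ (Set.Ioo (u - r) (u + r)) ≤ d * ENNReal.ofReal ((2 * r) ^ α))
    (x : ℝ) {ε : ℝ} (hε : 0 < ε) :
    ∫⁻ s, ENNReal.ofReal (lorentzian x ε s) ∂averagedSpectralMeasure μ A φ ≤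
      d * ENNReal.ofReal ((2 * ε) ^ α / ε * (1 + Real.pi / 2)) := by
  rw [lintegral_lorentzian_averagedSpectralMeasure μ hA hφ x hε]
  set z : ℂ := ⟨x, -ε⟩
  set F := ⟪φ, resolvent A z φ⟫_ℂ with hFdef
  have hz : z.im ≠ 0 := (neg_neg_of_pos hε).ne
  have hF1 : F.im = -ε * ‖resolvent A z φ‖ ^ 2 := hA.im_inner_resolvent hz φ
  have hy : 0 < ‖resolvent A z φ‖ := by
    refine norm_pos_iff.mpr fun h => ?_
    obtain ⟨h1, h2⟩ := hA.resolvent_spec hz φ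
    have h3 : (⟨resolvent A z φ, h1⟩ : A.domain) = 0 := Subtype.ext h
    rw [h3, LinearPMap.map_zero, h, smul_zero, sub_zero] at h2
    simp [← h2] at hφ
  have hF : F.im < 0 := by
    rw [hF1]
    nlinarith [mul_pos hε (pow_pos hy 2)]
  have hF0 : F ≠ 0 := fun h => by simp [h] at hF
  have hFn : 0 < Complex.normSq F := Complex.normSq_pos.mpr hF0
  set v := -F.im / Complex.normSq F with hv
  have hFle : Complex.normSq F ≤ ‖resolvent A z φ‖ ^ 2 := by
    rw [Complex.normSq_eq_norm_sq]
    refine pow_le_pow_left₀ (norm_nonneg _) ?_ 2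
    have := norm_inner_le_norm (𝕜 := ℂ) φ (resolvent A z φ)
    rwa [hφ, one_mul] at this
  -- As -Im F = ε‖(A - z)⁻¹φ‖² and |F| ≤ ‖(A - z)⁻¹φ‖, the kernel in t is at least as wide as the
  -- one in s.
  have hεv : ε ≤ v := by
    rw [hv, le_div_iff₀ hFn, hF1]
    nlinarith
  simp_rw [aronszajnKrein_eq_lorentzian hF]
  refine (lintegral_lorentzian_le hα0 hα1 _ (hμ _) (hε.trans_le hεv)).trans ?_
  gcongr d * ENNReal.ofReal (?_ * _)
  have hvpos := hε.trans_le hεv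
  have h1 : 2 * v = 2 * ε * (v / ε) := by field_simp
  -- Here α ≤ 1 enters: (2v)^α / v does not increase when v grows from ε.
  have h2 : (v / ε) ^ α ≤ v / ε := by
    have h3 := Real.rpow_le_rpow_of_exponent_le ((one_le_div hε).mpr hεv) hα1
    rwa [Real.rpow_one] at h3
  rw [h1, Real.mul_rpow (by positivity) (by positivity), div_le_div_iff₀ hvpos hε]
  calc (2 * ε) ^ α * (v / ε) ^ α * ε ≤ (2 * ε) ^ α * (v / ε) * ε := by gcongr
    _ = (2 * ε) ^ α * v := by field_simp

end Averaging

/-! ### Hölder constants -/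

section Holder

variable {α : ℝ} {μ : Measure ℝ}

theorem measure_Ioo_le_holderConst (x : ℝ) {ε : ℝ} (hε : 0 < ε) :
    μ (Set.Ioo (x - ε) (x + ε)) ≤ holderConst α μ * ENNReal.ofReal ((2 * ε) ^ α) := by
  have h : 0 < ENNReal.ofReal ((2 * ε) ^ α) := ENNReal.ofReal_pos.mpr (by positivity)
  rw [← ENNReal.div_le_iff h.ne' ENNReal.ofReal_ne_top]
  exact le_iSup_of_le x (le_iSup_of_le ε (le_iSup_of_le hε le_rfl))

theorem holderConst_le_iff {c : ℝ≥0∞} : holderConst α μ ≤ c ↔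
    ∀ x ε : ℝ, 0 < ε → μ (Set.Ioo (x - ε) (x + ε)) ≤ c * ENNReal.ofReal ((2 * ε) ^ α) := by
  simp only [holderConst, iSup_le_iff]
  refine forall_congr' fun x => forall_congr' fun ε => forall_congr' fun hε => ?_
  have h : 0 < ENNReal.ofReal ((2 * ε) ^ α) := ENNReal.ofReal_pos.mpr (by positivity)
  rw [ENNReal.div_le_iff h.ne' ENNReal.ofReal_ne_top]

theorem isUniformlyHolder_of_holderConst_lt_top [IsProbabilityMeasure μ]
    (h : holderConst α μ < ∞) : IsUniformlyHolder α μ := by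
  refine ⟨inferInstance, lt_of_le_of_lt ?_ h⟩
  exact iSup_mono fun x => iSup_mono fun ε => iSup_le fun hε => le_iSup_of_le hε.1 le_rfl

/-- Radii above 1 cost nothing: there (2ε)^α ≥ 1, and a probability measure has mass at most 1. -/
theorem IsUniformlyHolder.holderConst_lt_top (hα0 : 0 ≤ α) (h : IsUniformlyHolder α μ) :
    holderConst α μ < ∞ := by
  have := h.1
  refine lt_of_le_of_lt ?_ (max_lt h.2 ENNReal.one_lt_top)
  refine iSup_le fun x => iSup_le fun ε => iSup_le fun hε => ?_
  by_cases hε1 : ε ≤ 1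
  · exact le_max_of_le_left (le_iSup_of_le x (le_iSup_of_le ε (le_iSup_of_le ⟨hε, hε1⟩ le_rfl)))
  · refine le_max_of_le_right (ENNReal.div_le_of_le_mul ?_)
    push Not at hε1
    rw [one_mul]
    refine prob_le_one.trans (ENNReal.one_le_ofReal.mpr ?_)
    exact Real.one_le_rpow (by linarith) hα0

theorem holderConst_averagedSpectralMeasure_le {H : Type*} [NormedAddCommGroup H]
    [InnerProductSpace ℂ H] [CompleteSpace H] {A : H →ₗ.[ℂ] H} {φ : H} [SFinite μ]
    (hA : IsSymmetricWithResolvents A) (hφ : ‖φ‖ = 1) (hα0 : 0 ≤ α) (hα1 : α ≤ 1) :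
    holderConst α (averagedSpectralMeasure μ A φ) ≤
      ENNReal.ofReal (2 ^ (2 - α) * Real.pi) * holderConst α μ := by
  rw [holderConst_le_iff]
  intro x ε hε
  have h1 : 2 + Real.pi ≤ 2 ^ (2 - α) * Real.pi := by
    have h2 : (2 : ℝ) ^ (1 : ℝ) ≤ 2 ^ (2 - α) :=
      Real.rpow_le_rpow_of_exponent_le one_le_two (by linarith)
    rw [Real.rpow_one] at h2
    nlinarith [Real.pi_gt_three]
  calc averagedSpectralMeasure μ A φ (Set.Ioo (x - ε) (x + ε))
      ≤ ENNReal.ofReal (2 * ε) * (holderConst α μ *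
          ENNReal.ofReal ((2 * ε) ^ α / ε * (1 + Real.pi / 2))) :=
        (measure_Ioo_le_lintegral_lorentzian _ x hε).trans (mul_le_mul_right
          (lintegral_lorentzian_averagedSpectralMeasure_le hA hφ hα0 hα1
            (fun u r hr => measure_Ioo_le_holderConst u hr) x hε) _)
    _ = ENNReal.ofReal (2 + Real.pi) * holderConst α μ * ENNReal.ofReal ((2 * ε) ^ α) := by
        rw [mul_left_comm, ← ENNReal.ofReal_mul (by positivity), mul_comm (ENNReal.ofReal (2 + _)),
          mul_assoc (holderConst α μ), ← ENNReal.ofReal_mul (by positivity)]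
        congr 2
        field_simp
    _ ≤ _ := by gcongr

/-- The Poisson integral depends on ω only through F(ω), in an integrand jointly measurable in (F,
t). -/
theorem measurable_averagedSpectralMeasure {H : Type*} [NormedAddCommGroup H]
    [InnerProductSpace ℂ H] [CompleteSpace H] [TopologicalSpace.SeparableSpace H]
    {Ω : Type*} [MeasurableSpace Ω] {A : Ω → H →ₗ.[ℂ] H} (hA : IsSelfAdjointRandomOperator A)
    {φ : H} (hφ : ‖φ‖ = 1) (μ : Measure ℝ) [IsProbabilityMeasure μ] :
    Measurable fun ω => averagedSpectralMeasure μ (A ω) φ := by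
  have hA' := fun ω => isSymmetricWithResolvents_of_isSelfAdjoint (hA.1 ω)
  have := fun ω => isProbabilityMeasure_averagedSpectralMeasure μ (hA' ω) hφ
  refine measurable_of_measurable_lintegral_lorentzian _ fun x ε hε => ?_
  simp_rw [fun ω => lintegral_lorentzian_averagedSpectralMeasure μ (hA' ω) hφ x hε]
  have h := measurable_inner_resolvent hA (z := ⟨x, -ε⟩) (neg_neg_of_pos hε) φ φ
  exact ((measurable_aronszajnKrein.comp
    ((h.comp measurable_fst).prodMk measurable_snd)).ennreal_ofReal).lintegral_prod_right'

theorem isUniformlyHolder_bind {Ω : Type*} [MeasurableSpace Ω] {P : Measure Ω}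
    [IsProbabilityMeasure P] {κ : Ω → Measure ℝ} [∀ ω, IsProbabilityMeasure (κ ω)]
    (hκ : Measurable κ) {c : ℝ≥0∞} (hc : c < ∞) (h : ∀ ω, holderConst α (κ ω) ≤ c) :
    IsUniformlyHolder α (P.bind κ) := by
  have := isProbabilityMeasure_bind (m := P) hκ.aemeasurable
    (Filter.Eventually.of_forall fun ω => inferInstance)
  refine isUniformlyHolder_of_holderConst_lt_top (lt_of_le_of_lt ?_ hc)
  rw [holderConst_le_iff]
  intro x ε hε
  rw [Measure.bind_apply measurableSet_Ioo hκ.aemeasurable]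
  refine (lintegral_mono fun ω => holderConst_le_iff.mp (h ω) x ε hε).trans ?_
  simp

end Holder

end RankOneAveraging

end

open RankOneAveraging in
theorem theorem1p1
    {H : Type*} [NormedAddCommGroup H] [InnerProductSpace ℂ H] [CompleteSpace H]
    [TopologicalSpace.SeparableSpace H]
    {Ω : Type*} [MeasurableSpace Ω] (P : Measure Ω) [IsProbabilityMeasure P]
    (A : Ω → H →ₗ.[ℂ] H) (hA : IsSelfAdjointRandomOperator A)
    (q : Ω → ℝ) (hq : Measurable q)
    (hAq : IsIndependentOf P A q)
    (φ : H) (hφ : ‖φ‖ = 1)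
    (μ : Measure ℝ) (hμ : P.map q = μ)
    (α : ℝ) (hα0 : 0 < α) (hα1 : α ≤ 1) (hμα : IsUniformlyHolder α μ) :
    -- the averages below are averages of measurable families of measures
    (∀ ω, Measurable (perturbedSpectralMeasure (A ω) φ)) ∧
    (Measurable fun ω => averagedSpectralMeasure μ (A ω) φ) ∧
    -- (1) uniform Hölder continuity for each fixed value of the random operator
    (∀ ω, IsUniformlyHolder α (averagedSpectralMeasure μ (A ω) φ)) ∧
    -- (2) the bound on the constant, uniform in `ω`
    (∀ ω, holderConst α (averagedSpectralMeasure μ (A ω) φ) ≤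
      ENNReal.ofReal (2 ^ (2 - α) * Real.pi) * holderConst α μ) ∧
    -- (3) uniform Hölder continuity of the expectation
    IsUniformlyHolder α (P.bind fun ω => averagedSpectralMeasure μ (A ω) φ) := by
  have hA' := fun ω => isSymmetricWithResolvents_of_isSelfAdjoint (hA.1 ω)
  have := hμα.1
  have hprob := fun ω => isProbabilityMeasure_averagedSpectralMeasure μ (hA' ω) hφ
  have hle := fun ω => holderConst_averagedSpectralMeasure_le (μ := μ) (hA' ω) hφ hα0.le hα1
  have hlt : ENNReal.ofReal (2 ^ (2 - α) * Real.pi) * holderConst α μ < ∞ :=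
    ENNReal.mul_lt_top ENNReal.ofReal_lt_top (hμα.holderConst_lt_top hα0.le)
  have hmeas := measurable_averagedSpectralMeasure hA hφ μ
  exact ⟨fun ω => measurable_perturbedSpectralMeasure (hA' ω) hφ, hmeas,
    fun ω => isUniformlyHolder_of_holderConst_lt_top ((hle ω).trans_lt hlt), hle,
    isUniformlyHolder_bind hmeas hlt hle⟩
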